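/- Let $\Bbbk$ be a field of characteristic zero. A counital cocommutative $\Bbbk$-coalgebra $C$ is called conilpotent if it has a group-like element $1$ such that $C=\bigcup_n F_nC$, where $F_0C=\Bbbk 1$ and $F_{n}C=\{x : \Delta x-x\otimes 1-1\otimes x\in F_{n-1}C\otimes F_{n-1}C\}$; the element $1$ is then unique. Put $\mathrm{Prim}(C)=\{x\in C:\Delta x=x\otimes 1+1\otimes x\}$, and say that $C$ is of finite type if $\dim_\Bbbk \mathrm{Prim}(C)<\infty$. Let $\Bbbk[C]=\mathrm{Hom}_\Bbbk(C,\Bbbk)$ be the dual algebra, with its $\mathfrak m$-adic topology, where $\mathfrak m=\{\varphi : \varphi(1)=0\}$. A morphism $C\to D$ of finite-type conilpotent cocommutative coalgebras is a formal submersion if the dual map $\Bbbk[D]\to\Bbbk[C]$ is a formally smooth map of topological rings, and $C$ is a pointed formal manifold if its counit $C\to\Bbbk$ is a formal submersion. Let $\mathsf{FmlMfd}_*$ be the category of pointed formal manifolds and all coalgebra morphisms between them. A pointed formal $\infty$-groupoid is a simplicial object $\mathscr X_\bullet$ in $\mathsf{FmlMfd}_*$ such that for all $n\ge 1$ and $0\le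 i\le n$ the horn object $\mathrm{Hom}(\Lambda^n_i,\mathscr X_\bullet)$ exists in $\mathsf{FmlMfd}_*$ and the canonical morphism $\mathscr X_n\to \mathrm{Hom}(\Lambda^n_i,\mathscr X_\bullet)$ is a formal submersion. Let $\Delta_+\subseteq\Delta$ be the wide subcategory of morphisms $\theta$ with $\theta(0)=0$. An almost simplicial object of a category $\mathcal C$ is a functor $\Delta_+^{\mathrm{op}}\to\mathcal C$, and $U^+$ denotes restriction of simplicial objects to $\Delta_+^{\mathrm{op}}$ (it forgets the face maps $d_0$). For a vector space $V$ let $\mathrm{Sym}^{\mathrm{co}}(V)$ be the symmetric coalgebra on $V$ (the cofree conilpotent cocommutative coalgebra cogenerated by $V$), i.e. the symmetric algebra with the multiplicative coproduct determined by $\Delta v=v\otimes 1+1\otimes v$ for $v\in V$. Theorem. Every pointed formal $\infty$-groupoid $\mathscr X_\bullet$ over $\Bbbk$ admits a PBW basis: there is an isomorphism of almost simplicial coalgebras $$U^+\mathscr X_\bullet\;\cong\;\mathrm{Sym}^{\mathrm{co}}\bigl(U^+\mathrm{Prim}(\mathscr X_\bullet)\bigr),$$ where $\mathrm{Prim}$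 and $\mathrm{Sym}^{\mathrm{co}}$ are applied in each simplicial degree. In other words, there are coalgebra isomorphisms $\mathscr X_n\cong\mathrm{Sym}^{\mathrm{co}}(\mathrm{Prim}(\mathscr X_n))$, $n\ge 0$, compatible with all degeneracies and with all face maps $d_i$, $i\ge 1$. -/

import Mathlib

open CategoryTheory CategoryTheory.Limits Opposite TensorProduct Simplicial

universe u v w

namespace PBW

noncomputable section

/-! ### Conilpotent coalgebras and their primitives -/

section Coalgebras

variable (k : Type u) [Field k]

/-- The linear map `x ↦ Δ x - x ⊗ e - e ⊗ x`. -/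
def reducedComul {C : Type v} [AddCommGroup C] [Module k C] [Coalgebra k C] (e : C) :
    C →ₗ[k] C ⊗[k] C :=
  Coalgebra.comul - (TensorProduct.mk k C C).flip e - TensorProduct.mk k C C e

/-- The primitive filtration attached to `e`: `F 0 = k e`, and `F (n + 1)` consists of all `x`
with `Δ x - x ⊗ e - e ⊗ x ∈ F n ⊗ F n` (as a subspace of `C ⊗ C`). -/
def primFiltration {C : Type v} [AddCommGroup C] [Module k C] [Coalgebra k C] (e : C)
    (n : ℕ) : Submodule k C :=
  Nat.rec (Submodule.span k {e})
    (fun _ F => (LinearMap.range (TensorProduct.mapIncl F F)).comap (reducedComul k e)) n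

/-- A counital coalgebra is conilpotent (connected) if it has a group-like element `e` whose
primitive filtration exhausts the coalgebra. -/
class IsConilpotent (C : Type v) [AddCommGroup C] [Module k C] [Coalgebra k C] : Prop where
  exists_coaug : ∃ e : C, IsGroupLikeElem k e ∧ ∀ x : C, ∃ n : ℕ, x ∈ primFiltration k e n

/-- A conilpotent coalgebra has only one group-like element. -/
theorem groupLike_unique {C : Type v} [AddCommGroup C] [Module k C] [Coalgebra k C] {e g : C}
    (he : IsGroupLikeElem k e) (hF : ∀ x : C, ∃ n : ℕ, x ∈ primFiltration k e n)
    (hg : IsGroupLikeElem k g) : g = e := by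
  have hred : reducedComul k e (g - e) = (g - e) ⊗ₜ[k] (g - e) := by
    simp [reducedComul, he.comul_eq_tmul_self, hg.comul_eq_tmul_self, TensorProduct.sub_tmul,
      TensorProduct.tmul_sub]
    abel
  have key : ∀ n : ℕ, g - e ∈ primFiltration k e n → g - e = 0 := by
    intro n
    induction n with
    | zero =>
      intro h
      obtain ⟨c, hc⟩ := Submodule.mem_span_singleton.mp h
      have h1 := congrArg (Coalgebra.counit (R := k)) hc
      simp [he.counit_eq_one, hg.counit_eq_one] at h1
      rw [← hc, h1, zero_smul]
    | succ n ih =>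
      intro h
      apply ih
      by_contra hn
      obtain ⟨f, hf, hker⟩ := Submodule.exists_le_ker_of_notMem hn
      have hmem : reducedComul k e (g - e) ∈
        LinearMap.range (TensorProduct.mapIncl (primFiltration k e n)
          (primFiltration k e n)) := h
      obtain ⟨t, ht⟩ := hmem
      have hz : (LinearMap.mul' k k ∘ₗ TensorProduct.map f f) ∘ₗ
          TensorProduct.mapIncl (primFiltration k e n) (primFiltration k e n) = 0 := by
        ext a b
        have ha : f (a : C) = 0 := hker a.2
        simp [TensorProduct.mapIncl, ha]
      have h0 := LinearMap.congr_fun hz t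
      rw [LinearMap.comp_apply, ht, hred] at h0
      simp at h0
      exact hf (by simpa using h0)
  obtain ⟨n, hn⟩ := hF (g - e)
  exact sub_eq_zero.mp (key n hn)

/-- The canonical coaugmentation of a conilpotent coalgebra, as an element. -/
def coaug (C : Type v) [AddCommGroup C] [Module k C] [Coalgebra k C] [IsConilpotent k C] : C :=
  (IsConilpotent.exists_coaug (k := k) (C := C)).choose

theorem coaug_isGroupLike (C : Type v) [AddCommGroup C] [Module k C] [Coalgebra k C]
    [IsConilpotent k C] : IsGroupLikeElem k (coaug k C) :=
  (IsConilpotent.exists_coaug (k := k) (C := C)).choose_spec.1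

theorem coaug_exhausts (C : Type v) [AddCommGroup C] [Module k C] [Coalgebra k C]
    [IsConilpotent k C] (x : C) : ∃ n : ℕ, x ∈ primFiltration k (coaug k C) n :=
  (IsConilpotent.exists_coaug (k := k) (C := C)).choose_spec.2 x

/-- Coalgebra morphisms preserve the canonical coaugmentations. -/
theorem map_coaug {C : Type v} {D : Type w} [AddCommGroup C] [Module k C] [Coalgebra k C]
    [IsConilpotent k C] [AddCommGroup D] [Module k D] [Coalgebra k D] [IsConilpotent k D]
    (f : C →ₗc[k] D) : f (coaug k C) = coaug k D :=
  groupLike_unique k (coaug_isGroupLike k D) (coaug_exhausts k D)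
    ((coaug_isGroupLike k C).map f)

/-- The space of primitive elements, `Δ x = x ⊗ 1 + 1 ⊗ x`, where `1` is the coaugmentation. -/
def primitives (C : Type v) [AddCommGroup C] [Module k C] [Coalgebra k C] [IsConilpotent k C] :
    Submodule k C where
  carrier := {x | Coalgebra.comul (R := k) x = x ⊗ₜ[k] coaug k C + coaug k C ⊗ₜ[k] x}
  zero_mem' := by simp
  add_mem' {x y} hx hy := by
    simp only [Set.mem_ofPred_eq] at hx hy ⊢
    rw [map_add, hx, hy, TensorProduct.add_tmul, TensorProduct.tmul_add]
    abel
  smul_mem' c x hx := by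
    simp only [Set.mem_ofPred_eq] at hx ⊢
    rw [map_smul, hx, smul_add, TensorProduct.smul_tmul', TensorProduct.tmul_smul]

/-- The map on primitive elements induced by a coalgebra morphism. -/
def primitivesMap {C : Type v} {D : Type w} [AddCommGroup C] [Module k C] [Coalgebra k C]
    [IsConilpotent k C] [AddCommGroup D] [Module k D] [Coalgebra k D] [IsConilpotent k D]
    (f : C →ₗc[k] D) : primitives k C →ₗ[k] primitives k D :=
  (f : C →ₗ[k] D).restrict (fun x hx => by
    have hx' : Coalgebra.comul (R := k) x = x ⊗ₜ[k] coaug k C + coaug k C ⊗ₜ[k] x := hx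
    change Coalgebra.comul (R := k) (f x) = f x ⊗ₜ[k] coaug k D + coaug k D ⊗ₜ[k] f x
    rw [← CoalgHomClass.map_comp_comul_apply, hx', map_add, TensorProduct.map_tmul,
      TensorProduct.map_tmul]
    simp [map_coaug k f])

/-! ### Algebras of functions and formal submersions -/

/-- The algebra of functions `k[C]`: the full linear dual of `C` with the convolution product. -/
abbrev FunctionAlgebra (C : Type v) [AddCommGroup C] [Module k C] [Coalgebra k C] :
    Type (max u v) :=
  WithConv (C →ₗ[k] k)

/-- The algebra map `k[D] → k[C]` dual to a coalgebra morphism `C → D`. -/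
def dualMap {C : Type v} {D : Type w} [AddCommGroup C] [Module k C] [Coalgebra k C]
    [AddCommGroup D] [Module k D] [Coalgebra k D] (f : C →ₗc[k] D) :
    FunctionAlgebra k D →+* FunctionAlgebra k C where
  toFun φ := WithConv.toConv (φ.ofConv ∘ₗ (f : C →ₗ[k] D))
  map_one' := by ext x; simp [LinearMap.convOne_def]
  map_mul' φ ψ := by
    apply WithConv.ofConv_injective
    exact LinearMap.convMul_comp_coalgHom_distrib φ ψ f
  map_zero' := rfl
  map_add' _ _ := rfl

/-- The maximal ideal of `k[C]`, for `C` conilpotent: the functions vanishing at the base point,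
i.e. at the coaugmentation. -/
def maxIdeal (C : Type v) [AddCommGroup C] [Module k C] [Coalgebra k C] [IsConilpotent k C]
    [Coalgebra.IsCocomm k C] : Ideal (FunctionAlgebra k C) where
  carrier := {φ | φ (coaug k C) = 0}
  zero_mem' := rfl
  add_mem' {φ ψ} hφ hψ := by
    simp only [Set.mem_ofPred_eq] at hφ hψ ⊢
    simp [hφ, hψ]
  smul_mem' ψ φ hφ := by
    simp only [Set.mem_ofPred_eq] at hφ ⊢
    rw [smul_eq_mul, LinearMap.convMul_apply, (coaug_isGroupLike k C).comul_eq_tmul_self]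
    simp [hφ]

/-- Formal smoothness of a ring map `φ : R → S` for the `n`-adic topology on `S`: for every
square-zero ideal `J` of a ring `A`, every commutative square formed by `φ`, `A → A ⧸ J`, a ring
map `R → A` and a ring map `S → A ⧸ J` which is continuous (it kills a power of `n`; the rings
`A`, `A ⧸ J` are discrete) has a diagonal filler `S → A`.
The filler is automatically continuous, as it kills a power of `n` too; likewise the map `R → A`
is automatically continuous for the topology of any ideal of `R` which `φ` maps into `n`. -/
def FormallySmoothAdic {R : Type v} {S : Type w} [CommRing R] [CommRing S] (φ : R →+* S)
    (n : Ideal S) : Prop :=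
  ∀ (A : Type (max v w)) [CommRing A] (J : Ideal A), J ^ 2 = ⊥ →
    ∀ (g : R →+* A) (h : S →+* A ⧸ J), (∃ N : ℕ, n ^ N ≤ RingHom.ker h) →
      h.comp φ = (Ideal.Quotient.mk J).comp g →
      ∃ l : S →+* A, (Ideal.Quotient.mk J).comp l = h ∧ l.comp φ = g

/-- A morphism `f : C → D` of cocommutative coalgebras, with `C` conilpotent, is a formal
submersion if the dual map `k[D] → k[C]` is formally smooth for the adic topology on `k[C]`. -/
def IsFormalSubmersion {C D : Type v} [AddCommGroup C] [Module k C] [Coalgebra k C]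
    [Coalgebra.IsCocomm k C] [IsConilpotent k C] [AddCommGroup D] [Module k D] [Coalgebra k D]
    [Coalgebra.IsCocomm k D] (f : C →ₗc[k] D) : Prop :=
  FormallySmoothAdic (dualMap k f) (maxIdeal k C)

/-! ### The categories of conilpotent coalgebras and of pointed formal manifolds -/

/-- Finite-type conilpotent cocommutative counital coalgebras; finite type means that the space of
primitive elements is finite-dimensional. -/
structure IsFiniteTypeConil (C : CoalgCat.{u} k) : Prop where
  cocomm : Coalgebra.IsCocomm k C
  conil : IsConilpotent k C
  finite : Module.Finite k (primitives k C)

/-- The category of finite-type conilpotent cocommutative counital coalgebras, a full subcategory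
of the category of coalgebras. -/
abbrev ConilCoalg : Type (u + 1) :=
  ObjectProperty.FullSubcategory (IsFiniteTypeConil k)

instance (C : ConilCoalg k) : Coalgebra.IsCocomm k C.obj := C.property.cocomm

instance (C : ConilCoalg k) : IsConilpotent k C.obj := C.property.conil

instance (C : ConilCoalg k) : Module.Finite k (primitives k C.obj) := C.property.finite

/-- Pointed formal manifolds: the counit `C → k` is a formal submersion. -/
def IsFormalManifold (C : ConilCoalg k) : Prop :=
  IsFormalSubmersion k (Coalgebra.counitCoalgHom k C.obj)

/-- The category of pointed formal manifolds, a full subcategory of the category of finite-type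
conilpotent cocommutative coalgebras. -/
abbrev FormalManifold : Type (u + 1) :=
  ObjectProperty.FullSubcategory (IsFormalManifold k)

/-- The underlying coalgebra of a pointed formal manifold (a fully faithful functor). -/
abbrev toCoalg : FormalManifold k ⥤ CoalgCat.{u} k :=
  ObjectProperty.ι (IsFormalManifold k) ⋙ ObjectProperty.ι (IsFiniteTypeConil k)

/-- The covers in the category of pointed formal manifolds: the formal submersions. -/
def covers : MorphismProperty (FormalManifold k) :=
  fun C D f => IsFormalSubmersion k (C := C.obj.obj) (D := D.obj.obj) f.hom.hom.toCoalgHom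

/-- The functor of primitive elements. -/
def primFunctor : ConilCoalg k ⥤ ModuleCat.{u} k where
  obj C := ModuleCat.of k (primitives k C.obj)
  map f := ModuleCat.ofHom (primitivesMap k f.hom.toCoalgHom)

/-! ### The symmetric coalgebra -/

/-- The coalgebra morphism `Sym V → Sym W` induced by a linear map. -/
def symMap {V W : Type u} [AddCommGroup V] [Module k V] [AddCommGroup W] [Module k W]
    (f : V →ₗ[k] W) : SymmetricAlgebra k V →ₗc[k] SymmetricAlgebra k W :=
  let F : SymmetricAlgebra k V →ₐ[k] SymmetricAlgebra k W :=
    SymmetricAlgebra.lift (SymmetricAlgebra.ι k W ∘ₗ f)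
  { F.toLinearMap with
    counit_comp := by
      have h : (Bialgebra.counitAlgHom k (SymmetricAlgebra k W)).comp F =
          Bialgebra.counitAlgHom k (SymmetricAlgebra k V) := by
        ext x
        simp [F, SymmetricAlgebra.algebraMapInv_ι]
      exact congrArg AlgHom.toLinearMap h
    map_comp_comul := by
      have h : (Algebra.TensorProduct.map F F).comp
            (Bialgebra.comulAlgHom k (SymmetricAlgebra k V)) =
          (Bialgebra.comulAlgHom k (SymmetricAlgebra k W)).comp F := by
        ext x
        simp [F]
      exact congrArg AlgHom.toLinearMap h }

/-- The symmetric coalgebra functor `Sym^co`: the coalgebra underlying the symmetric algebra of `V`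
with the coproduct for which `V` consists of primitive elements, `Δ v = v ⊗ 1 + 1 ⊗ v`. In
characteristic zero it is the cofree conilpotent cocommutative coalgebra cogenerated by `V`. -/
def symCo : ModuleCat.{u} k ⥤ CoalgCat.{u} k where
  obj V := CoalgCat.of k (SymmetricAlgebra k V)
  map f := CoalgCat.ofHom (symMap k f.hom)
  map_id V := by
    have h : SymmetricAlgebra.lift (SymmetricAlgebra.ι k V ∘ₗ LinearMap.id) =
        AlgHom.id k (SymmetricAlgebra k V) := by
      ext x
      simp
    apply CoalgCat.hom_ext
    apply CoalgHom.ext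
    intro x
    exact DFunLike.congr_fun h x
  map_comp {U V W} f g := by
    have h : SymmetricAlgebra.lift (SymmetricAlgebra.ι k W ∘ₗ (g.hom ∘ₗ f.hom)) =
        (SymmetricAlgebra.lift (SymmetricAlgebra.ι k W ∘ₗ g.hom)).comp
          (SymmetricAlgebra.lift (SymmetricAlgebra.ι k V ∘ₗ f.hom)) := by
      ext x
      simp
    apply CoalgCat.hom_ext
    apply CoalgHom.ext
    intro x
    exact DFunLike.congr_fun h x

end Coalgebras

/-! ### Kan simplicial objects -/

section Kan

variable {𝒞 : Type v} [Category.{w} 𝒞]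

/-- The diagram of all `X m`, indexed by the simplices `Δ^m → S` of a simplicial set `S`. Its limit
is the matching object `X^S = Hom(S, X)`. -/
abbrev matchingDiagram (S : SSet.{0}) (X : SimplicialObject 𝒞) : S.Elements ⥤ 𝒞 :=
  CategoryOfElements.π S ⋙ X

/-- For a simplicial subset `S` of `Δ^n`, the canonical cone over `matchingDiagram S X` with apex
`X n`: its component at a simplex `s : Δ^m → S ⊆ Δ^n` is `X s : X n → X m`. It induces the
canonical morphism `X n → X^S`. -/
def restrictionCone (X : SimplicialObject 𝒞) {n : ℕ} (S : (Δ[n] : SSet.{0}).Subcomplex) :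
    Cone (matchingDiagram (S : SSet.{0}) X) where
  pt := X _⦋n⦌
  π :=
    { app := fun s => X.map (SSet.stdSimplex.objEquiv s.2.1).op
      naturality := fun s t f => by
        have h : (SSet.stdSimplex.objEquiv t.2.1).op =
            (SSet.stdSimplex.objEquiv s.2.1).op ≫ f.1 := by
          obtain ⟨f, hf⟩ := f
          have hf' := congrArg Subtype.val hf
          rw [← hf']
          rfl
        refine (Category.id_comp _).trans ?_
        exact (congrArg X.map h).trans (X.map_comp _ _) }

/-- A simplicial object `X` is an `∞`-groupoid object with respect to a class `W` of covers if for
all `n ≥ 1` and `0 ≤ i ≤ n` the horn object `X^{Λ^n_i}` exists and the canonical morphism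
`X n → X^{Λ^n_i}` is a cover. -/
def IsInftyGroupoid (W : MorphismProperty 𝒞) (X : SimplicialObject 𝒞) : Prop :=
  ∀ (n : ℕ), 1 ≤ n → ∀ (i : Fin (n + 1)),
    ∃ (c : Cone (matchingDiagram (SSet.horn.{0} n i : SSet.{0}) X)) (hc : IsLimit c),
      W (hc.lift (restrictionCone X (SSet.horn.{0} n i)))

/-! ### Almost simplicial objects -/

/-- The class of morphisms `θ` of the simplex category with `θ 0 = 0`. -/
def fixesZero : MorphismProperty SimplexCategory :=
  fun _ _ θ => θ.toOrderHom 0 = 0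

instance : fixesZero.IsMultiplicative where
  id_mem _ := rfl
  comp_mem f g hf hg := by
    change g.toOrderHom (f.toOrderHom 0) = 0
    rw [show f.toOrderHom 0 = 0 from hf]
    exact hg

variable (𝒞) in
/-- Almost simplicial objects: presheaves on the wide subcategory of the simplex category whose
morphisms fix `0`. -/
abbrev AlmostSimplicialObject := (WideSubcategory fixesZero)ᵒᵖ ⥤ 𝒞

/-- The functor `U⁺` restricting a simplicial object to the morphisms which fix `0`; it forgets the
face maps `d₀`. -/
abbrev forgetFaceZero (X : SimplicialObject 𝒞) : AlmostSimplicialObject 𝒞 :=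
  (wideSubcategoryInclusion fixesZero).op ⋙ X

end Kan

/-! ### PBW bases -/

section PBWBasis

variable (k : Type u) [Field k]

/-- The simplicial vector space of primitive elements of a simplicial pointed formal manifold. -/
abbrev primSimplicial (X : SimplicialObject (FormalManifold k)) :
    SimplicialObject (ModuleCat.{u} k) :=
  X ⋙ ObjectProperty.ι (IsFormalManifold k) ⋙ primFunctor k

/-- A PBW basis of `X`: an isomorphism `U⁺ X ≅ Sym^co (U⁺ (Prim X))` of almost simplicial
coalgebras. -/
abbrev PBWBasis (X : SimplicialObject (FormalManifold k)) : Type u :=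
  forgetFaceZero (X ⋙ toCoalg k) ≅ forgetFaceZero (primSimplicial k X) ⋙ symCo k

end PBWBasis

end

end PBW

/-!
By the cofreeness of `Sym^co V`, a morphism of coalgebras from a conilpotent cocommutative coalgebra
`C` to `Sym^co V` amounts to a linear map `r : C → V` which vanishes at the coaugmentation; the
morphism is the exponential of `r` in the convolution algebra `Hom(C, Sym V)` (`coalgExp`), and it is
natural in `C`, `V` and `r`. A PBW basis is therefore obtained from linear retractions
`X n → Prim (X n)` which commute with the simplicial operators fixing `0`.

Such retractions exist by linear algebra (`exists_retraction_of_map_zero`). By the Dold-Kan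
correspondence a simplicial vector space is `Γ₀ K`, for its normalized complex `K`, and the
differential of `K` enters `Γ₀ K` only through the face map `d₀`. Restricted to the operators fixing
`0`, the simplicial vector space depends on the graded vector space `K` alone, and every injection of
graded vector spaces splits.

It remains to see that `exp r : C → Sym^co (Prim C)` is bijective when `C` is a formal manifold and
`r` is a retraction onto `Prim C`.
* It is injective because it is injective on primitive elements and `C` is conilpotent
  (`injective_of_injective_on_primitives`).
* Surjectivity is an inverse function theorem (`surjective_of_isFormalSubmersion_counit`). Put
  `D = Sym^co (Prim C)`, with maximal ideal `m` of `k[D]`, and let `I n` be the ideal of functions on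
  `D` vanishing on the `n`-th step of the primitive filtration. If the functions vanishing on the image
  of `C` lie in `I n`, then `k[D] → k[D] ⧸ I n` factors through `k[C]`, and formal smoothness lifts the
  factorization to `k[C] → k[D] ⧸ I (n + 1)`. As `m * I n ≤ I (n + 1)`, the composite
  `k[D] → k[C] → k[D] ⧸ I (n + 1)` agrees with the reduction on `m ^ 2`, so functions in `m ^ 2` which
  vanish on the image of `C` lie in `I (n + 1)`. All functions vanishing on the image are in `m ^ 2`:
  the image contains degrees zero and one, and in characteristic zero `m ^ 2` contains all functions
  on `D` that vanish there, by inverting the Euler operator (`mem_maxIdeal_sq_of_vanishing`).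
-/

namespace PBW

noncomputable section

/-! ### Retractions of simplicial vector spaces over the operators fixing zero -/

section DoldKan
open AlgebraicTopology.DoldKan SimplicialObject

theorem epi_map_zero {m n : SimplexCategory} (e : m ⟶ n) [Epi e] : e.toOrderHom 0 = 0 := by
  obtain ⟨a, ha⟩ := SimplexCategory.epi_iff_surjective.mp ‹Epi e› 0
  have h := e.toOrderHom.monotone (Fin.zero_le a)
  rw [ha] at h
  exact le_antisymm h (Fin.zero_le _)

variable {𝒜 : Type v} [Category.{w} 𝒜] [Preadditive 𝒜]

/-- The only operator through which the differential of `K` enters `Γ₀ K` is `d₀`, which does not fix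
`0`. So along a monomorphism fixing `0`, maps which are merely graded are natural. -/
theorem mapMono_comp_graded {K L : ChainComplex 𝒜 ℕ} (φ : ∀ n, K.X n ⟶ L.X n)
    {m n : SimplexCategory} (i : m ⟶ n) [Mono i] (hi : i.toOrderHom 0 = 0) :
    Γ₀.Obj.Termwise.mapMono K i ≫ φ m.len = φ n.len ≫ Γ₀.Obj.Termwise.mapMono L i := by
  by_cases h : n = m
  · subst h
    obtain rfl := SimplexCategory.eq_id_of_mono i
    simp [Γ₀.Obj.Termwise.mapMono_id]
  · have hδ : ¬ Isδ₀ i := fun hδ => hδ.2 hi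
    rw [Γ₀.Obj.Termwise.mapMono_eq_zero K i h hδ, Γ₀.Obj.Termwise.mapMono_eq_zero L i h hδ,
      zero_comp, comp_zero]

/-- The action of an operator `θ` on the summand of `Γ₀ K` indexed by a surjection `A`, as a map to
the summand indexed by the surjective part of `θ ≫ A`. -/
def summandPull (K : ChainComplex 𝒜 ℕ) {Δ Δ' : SimplexCategoryᵒᵖ} (A : Splitting.IndexSet Δ)
    (θ : Δ ⟶ Δ') : K.X A.1.unop.len ⟶ K.X (A.pull θ).1.unop.len :=
  (Γ₀.Obj.Termwise.mapMono K (image.ι (θ.unop ≫ A.e)) :)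

theorem summandPull_comp_graded {K L : ChainComplex 𝒜 ℕ} (φ : ∀ n, K.X n ⟶ L.X n)
    {Δ Δ' : SimplexCategoryᵒᵖ} (A : Splitting.IndexSet Δ) (θ : Δ ⟶ Δ')
    (hθ : θ.unop.toOrderHom 0 = 0) :
    summandPull K A θ ≫ φ _ = φ _ ≫ summandPull L A θ := by
  refine mapMono_comp_graded φ (image.ι (θ.unop ≫ A.e)) ?_
  have h1 : (factorThruImage (θ.unop ≫ A.e) ≫ image.ι (θ.unop ≫ A.e)).toOrderHom 0 = 0 := by
    rw [image.fac]
    change A.e.toOrderHom (θ.unop.toOrderHom 0) = 0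
    rw [hθ, epi_map_zero]
  have h2 : (image.ι (θ.unop ≫ A.e)).toOrderHom
      ((factorThruImage (θ.unop ≫ A.e)).toOrderHom 0) = 0 := h1
  rwa [epi_map_zero] at h2

variable [HasFiniteCoproducts 𝒜]

/-- The inclusion in `Γ₀ K` of the summand indexed by a surjection `A`. -/
def summandInc (K : ChainComplex 𝒜 ℕ) {Δ : SimplexCategoryᵒᵖ} (A : Splitting.IndexSet Δ) :
    K.X A.1.unop.len ⟶ (Γ₀.obj K).obj Δ :=
  ((Γ₀.splitting K).cofan Δ).inj A

theorem summandInc_map (K : ChainComplex 𝒜 ℕ) {Δ Δ' : SimplexCategoryᵒᵖ}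
    (A : Splitting.IndexSet Δ) (θ : Δ ⟶ Δ') :
    summandInc K A ≫ (Γ₀.obj K).map θ = summandPull K A θ ≫ summandInc K (A.pull θ) :=
  Γ₀.Obj.map_on_summand' K A θ

theorem gamma_hom_ext {K : ChainComplex 𝒜 ℕ} {Δ : SimplexCategoryᵒᵖ} {Z : 𝒜}
    {f g : (Γ₀.obj K).obj Δ ⟶ Z} (h : ∀ A, summandInc K A ≫ f = summandInc K A ≫ g) : f = g :=
  (Γ₀.splitting K).hom_ext' _ _ h

/-- The map `Γ₀ K → Γ₀ L` in one simplicial degree induced by a map of graded objects, which need not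
commute with the differentials. -/
def gammaApp {K L : ChainComplex 𝒜 ℕ} (φ : ∀ n, K.X n ⟶ L.X n) (Δ : SimplexCategoryᵒᵖ) :
    (Γ₀.obj K).obj Δ ⟶ (Γ₀.obj L).obj Δ :=
  (Γ₀.splitting K).desc Δ fun A => φ _ ≫ summandInc L A

theorem summandInc_gammaApp {K L : ChainComplex 𝒜 ℕ} (φ : ∀ n, K.X n ⟶ L.X n)
    {Δ : SimplexCategoryᵒᵖ} (A : Splitting.IndexSet Δ) :
    summandInc K A ≫ gammaApp φ Δ = φ _ ≫ summandInc L A :=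
  (Γ₀.splitting K).ι_desc _ _ _

/-- Maps of graded objects induce maps which commute with all simplicial operators fixing `0`. -/
theorem gammaApp_comp_map {K L : ChainComplex 𝒜 ℕ} (φ : ∀ n, K.X n ⟶ L.X n)
    {Δ Δ' : SimplexCategoryᵒᵖ} (θ : Δ ⟶ Δ') (hθ : θ.unop.toOrderHom 0 = 0) :
    (Γ₀.obj K).map θ ≫ gammaApp φ Δ' = gammaApp φ Δ ≫ (Γ₀.obj L).map θ := by
  refine gamma_hom_ext fun A => ?_
  rw [← Category.assoc, summandInc_map, Category.assoc, summandInc_gammaApp, ← Category.assoc,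
    summandPull_comp_graded φ A θ hθ, Category.assoc, ← summandInc_map, ← Category.assoc,
    ← Category.assoc, summandInc_gammaApp]

theorem gammaApp_comp_eq_id {K L : ChainComplex 𝒜 ℕ} (f : K ⟶ L) (ψ : ∀ n, L.X n ⟶ K.X n)
    (h : ∀ n, f.f n ≫ ψ n = 𝟙 _) (Δ : SimplexCategoryᵒᵖ) :
    (Γ₀.map f).app Δ ≫ gammaApp ψ Δ = 𝟙 _ := by
  refine gamma_hom_ext fun A => ?_
  have h1 : summandInc K A ≫ (Γ₀.map f).app Δ = f.f _ ≫ summandInc L A :=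
    (Γ₀.splitting K).ι_desc _ _ _
  rw [← Category.assoc, h1, Category.assoc, summandInc_gammaApp, ← Category.assoc, h,
    Category.id_comp, Category.comp_id]

end DoldKan

open AlgebraicTopology.DoldKan in
/-- A monomorphism of simplicial vector spaces has a retraction which commutes with all simplicial
operators fixing `0`: under the Dold-Kan correspondence it suffices to choose a linear retraction of
the normalized complexes in each degree, and compatibility with the differential is not needed. -/
theorem exists_retraction_of_map_zero (k : Type u) [Field k]
    {V W : SimplicialObject (ModuleCat.{u} k)} (i : V ⟶ W) [Mono i] :
    ∃ ρ : ∀ Δ, W.obj Δ ⟶ V.obj Δ, (∀ Δ, i.app Δ ≫ ρ Δ = 𝟙 _) ∧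
      ∀ {Δ Δ' : SimplexCategoryᵒᵖ} (θ : Δ ⟶ Δ'), θ.unop.toOrderHom 0 = 0 →
        W.map θ ≫ ρ Δ' = ρ Δ ≫ V.map θ := by
  let E := Abelian.DoldKan.equivalence (A := ModuleCat.{u} k)
  let f := E.functor.map i
  have hmono : ∀ n, Mono (f.f n) := fun n =>
    inferInstanceAs (Mono ((HomologicalComplex.eval _ _ n).map f))
  have hs : ∀ n, ∃ ψ, f.f n ≫ ψ = 𝟙 _ := fun n => by
    obtain ⟨g, hg⟩ := (f.f n).hom.exists_leftInverse_of_injective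
      (LinearMap.ker_eq_bot.mpr ((ModuleCat.mono_iff_injective _).mp (hmono n)))
    exact ⟨ModuleCat.ofHom g, ModuleCat.hom_ext hg⟩
  choose ψ hψ using hs
  let η : ∀ X : SimplicialObject (ModuleCat.{u} k), X ≅ Γ₀.obj (E.functor.obj X) :=
    fun X => E.unitIso.app X
  have hη : i ≫ (η W).hom = (η V).hom ≫ Γ₀.map f := E.unitIso.hom.naturality i
  refine ⟨fun Δ => (η W).hom.app Δ ≫ gammaApp ψ Δ ≫ (η V).inv.app Δ, fun Δ => ?_,
    fun {Δ Δ'} θ hθ => ?_⟩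
  · rw [← NatTrans.comp_app_assoc, hη, NatTrans.comp_app_assoc,
      ← Category.assoc ((Γ₀.map f).app Δ), gammaApp_comp_eq_id f ψ hψ, Category.id_comp,
      ← NatTrans.comp_app, Iso.hom_inv_id, NatTrans.id_app]
  · rw [NatTrans.naturality_assoc, ← Category.assoc ((Γ₀.obj _).map θ),
      gammaApp_comp_map ψ θ hθ, Category.assoc, Category.assoc, Category.assoc,
      NatTrans.naturality]

/-! ### The primitive filtration and the convolution exponential -/

section Filtration

variable {k : Type u} [Field k] {C : Type v} [AddCommGroup C] [Module k C]

theorem range_mapIncl_mono {F G : Submodule k C} (h : F ≤ G) :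
    LinearMap.range (TensorProduct.mapIncl F F) ≤ LinearMap.range (TensorProduct.mapIncl G G) := by
  rw [TensorProduct.range_mapIncl, TensorProduct.range_mapIncl]
  exact Submodule.map₂_le_map₂ h h

theorem tmul_mem_range_mapIncl {F : Submodule k C} {x y : C} (hx : x ∈ F) (hy : y ∈ F) :
    x ⊗ₜ[k] y ∈ LinearMap.range (TensorProduct.mapIncl F F) :=
  ⟨⟨x, hx⟩ ⊗ₜ ⟨y, hy⟩, rfl⟩

variable [Coalgebra k C] {e : C}

theorem reducedComul_apply (e x : C) :
    reducedComul k e x = Coalgebra.comul (R := k) x - x ⊗ₜ[k] e - e ⊗ₜ[k] x := by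
  simp [reducedComul]

theorem reducedComul_map {D : Type w} [AddCommGroup D] [Module k D] [Coalgebra k D]
    (f : C →ₗc[k] D) (e x : C) :
    reducedComul k (f e) (f x) =
      TensorProduct.map f.toLinearMap f.toLinearMap (reducedComul k e x) := by
  rw [reducedComul_apply, reducedComul_apply, ← CoalgHomClass.map_comp_comul_apply]
  simp

theorem mem_primFiltration_zero {x : C} : x ∈ primFiltration k e 0 ↔ ∃ c : k, c • e = x :=
  Submodule.mem_span_singleton

theorem mem_primFiltration_succ {n : ℕ} {x : C} :
    x ∈ primFiltration k e (n + 1) ↔ reducedComul k e x ∈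
      LinearMap.range (TensorProduct.mapIncl (primFiltration k e n) (primFiltration k e n)) :=
  Iff.rfl

theorem primFiltration_le_succ (he : IsGroupLikeElem k e) (n : ℕ) :
    primFiltration k e n ≤ primFiltration k e (n + 1) := by
  induction n with
  | zero =>
    intro x hx
    obtain ⟨c, rfl⟩ := mem_primFiltration_zero.mp hx
    rw [mem_primFiltration_succ, map_smul, reducedComul_apply, he.comul_eq_tmul_self, sub_self,
      zero_sub]
    have h0 : e ∈ primFiltration k e 0 := mem_primFiltration_zero.mpr ⟨1, one_smul _ _⟩
    exact Submodule.smul_mem _ _ (Submodule.neg_mem _ (tmul_mem_range_mapIncl h0 h0))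
  | succ n ih => exact fun x hx => range_mapIncl_mono ih hx

theorem primFiltration_mono (he : IsGroupLikeElem k e) : Monotone (primFiltration k e) :=
  monotone_nat_of_le_succ (primFiltration_le_succ he)

theorem self_mem_primFiltration (he : IsGroupLikeElem k e) (n : ℕ) : e ∈ primFiltration k e n :=
  primFiltration_mono he n.zero_le (mem_primFiltration_zero.mpr ⟨1, one_smul _ _⟩)

end Filtration

section Convolution

variable {k : Type u} [Field k] {C : Type v} [AddCommGroup C] [Module k C] [Coalgebra k C]
  {A : Type w} [CommRing A] [Algebra k A]

theorem convMul_apply_of_isGroupLike {e : C} (he : IsGroupLikeElem k e)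
    (φ ψ : WithConv (C →ₗ[k] A)) : (φ * ψ) e = φ e * ψ e := by
  rw [LinearMap.convMul_apply, he.comul_eq_tmul_self]
  simp

/-- If `ψ` vanishes on `F n`, the reduced coproduct of `x ∈ F (n + 1)` contributes nothing to
`(φ * ψ) x`, and neither does `φ x * ψ e`. -/
theorem convMul_apply_of_vanishing {e : C} (he : IsGroupLikeElem k e) {n : ℕ}
    (φ : WithConv (C →ₗ[k] A)) {ψ : WithConv (C →ₗ[k] A)}
    (hψ : ∀ y ∈ primFiltration k e n, ψ y = 0) {x : C} (hx : x ∈ primFiltration k e (n + 1)) :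
    (φ * ψ) x = φ e * ψ x := by
  obtain ⟨t, ht⟩ := mem_primFiltration_succ.mp hx
  have hz : (LinearMap.mul' k A ∘ₗ TensorProduct.map φ.ofConv ψ.ofConv) ∘ₗ
      TensorProduct.mapIncl (primFiltration k e n) (primFiltration k e n) = 0 := by
    ext a b
    simp [TensorProduct.mapIncl, hψ b b.2]
  have h0 := LinearMap.congr_fun hz t
  rw [LinearMap.comp_apply, ht, reducedComul_apply] at h0
  have h1 : ψ e = 0 := hψ e (self_mem_primFiltration he n)
  rw [LinearMap.convMul_apply]
  simpa [h1, sub_eq_zero] using h0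

theorem convMul_vanishing {e : C} (he : IsGroupLikeElem k e) {n : ℕ}
    (φ : WithConv (C →ₗ[k] A)) {ψ : WithConv (C →ₗ[k] A)}
    (hψ : ∀ y ∈ primFiltration k e n, ψ y = 0) : ∀ y ∈ primFiltration k e n, (φ * ψ) y = 0 := by
  intro y hy
  cases n with
  | zero =>
    obtain ⟨c, rfl⟩ := mem_primFiltration_zero.mp hy
    rw [map_smul, convMul_apply_of_isGroupLike he, hψ e (self_mem_primFiltration he 0), mul_zero,
      smul_zero]
  | succ n =>
    rw [convMul_apply_of_vanishing he φ
      (fun z hz => hψ z (primFiltration_le_succ he n hz)) hy, hψ y hy, mul_zero]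

theorem convPow_apply_eq_zero {e : C} (he : IsGroupLikeElem k e) {a : WithConv (C →ₗ[k] A)}
    (ha : a e = 0) {n m : ℕ} (hnm : n < m) {x : C} (hx : x ∈ primFiltration k e n) :
    (a ^ m) x = 0 := by
  induction n generalizing m x with
  | zero =>
    obtain ⟨c, rfl⟩ := mem_primFiltration_zero.mp hx
    obtain ⟨m, rfl⟩ := Nat.exists_eq_succ_of_ne_zero hnm.ne'
    rw [pow_succ, map_smul, convMul_apply_of_isGroupLike he, ha, mul_zero, smul_zero]
  | succ n ih =>
    obtain ⟨m, rfl⟩ := Nat.exists_eq_succ_of_ne_zero (Nat.ne_zero_of_lt hnm)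
    rw [pow_succ', convMul_apply_of_vanishing he a (fun y hy => ih (by omega) hy) hx, ha, zero_mul]

theorem convPow_mul_convPow_apply_eq_zero {e : C} (he : IsGroupLikeElem k e)
    {a b : WithConv (C →ₗ[k] A)} (ha : a e = 0) (hb : b e = 0) {n i j : ℕ} (h : n < i + j) {x : C}
    (hx : x ∈ primFiltration k e n) : (a ^ i * b ^ j) x = 0 := by
  induction i generalizing n x with
  | zero => rw [pow_zero, one_mul]; exact convPow_apply_eq_zero he hb (by omega) hx
  | succ i ih =>
    cases n with
    | zero =>
      obtain ⟨c, rfl⟩ := mem_primFiltration_zero.mp hx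
      rw [map_smul, convMul_apply_of_isGroupLike he, pow_succ, convMul_apply_of_isGroupLike he, ha,
        mul_zero, zero_mul, smul_zero]
    | succ n =>
      rw [pow_succ', mul_assoc,
        convMul_apply_of_vanishing he a (fun y hy => ih (by omega) hy) hx, ha, zero_mul]

theorem algHom_comp_convPow {B : Type*} [CommRing B] [Algebra k B] (h : A →ₐ[k] B)
    (a : WithConv (C →ₗ[k] A)) (n : ℕ) :
    WithConv.toConv (h.toLinearMap ∘ₗ (a ^ n).ofConv) =
      WithConv.toConv (h.toLinearMap ∘ₗ a.ofConv) ^ n := by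
  induction n with
  | zero => ext x; simp
  | succ n ih =>
    rw [pow_succ, pow_succ, ← ih]
    exact WithConv.ofConv_injective (LinearMap.algHom_comp_convMul_distrib h _ _)

theorem convPow_comp_coalgHom {B : Type*} [AddCommGroup B] [Module k B] [Coalgebra k B]
    (g : B →ₗc[k] C) (a : WithConv (C →ₗ[k] A)) (n : ℕ) :
    WithConv.toConv ((a ^ n).ofConv ∘ₗ g.toLinearMap) =
      WithConv.toConv (a.ofConv ∘ₗ g.toLinearMap) ^ n := by
  induction n with
  | zero => ext x; simp
  | succ n ih =>
    rw [pow_succ, pow_succ, ← ih]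
    exact WithConv.ofConv_injective (LinearMap.convMul_comp_coalgHom_distrib _ _ g)

/-- A partial sum of the exponential series in the convolution algebra. -/
def convExpSum (a : WithConv (C →ₗ[k] A)) (N : ℕ) : WithConv (C →ₗ[k] A) :=
  ∑ i ∈ Finset.range N, (i.factorial : k)⁻¹ • a ^ i

theorem convExpSum_apply (a : WithConv (C →ₗ[k] A)) (N : ℕ) (x : C) :
    convExpSum a N x = ∑ i ∈ Finset.range N, (i.factorial : k)⁻¹ • (a ^ i) x := by
  simp [convExpSum, LinearMap.sum_apply]

theorem convExpSum_apply_congr {e : C} (he : IsGroupLikeElem k e) {a : WithConv (C →ₗ[k] A)}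
    (ha : a e = 0) {m n M N : ℕ} (hM : m < M) (hN : n < N) {x : C}
    (hm : x ∈ primFiltration k e m) (hn : x ∈ primFiltration k e n) :
    convExpSum a M x = convExpSum a N x := by
  wlog h : M ≤ N generalizing m n M N
  · exact (this hN hM hn hm (le_of_not_ge h)).symm
  rw [convExpSum_apply, convExpSum_apply]
  refine Finset.sum_subset (Finset.range_mono h) fun i _ hi => ?_
  rw [convPow_apply_eq_zero he ha (hM.trans_le (by simpa using hi)) hm, smul_zero]

theorem convExpSum_add_apply [CharZero k] [Coalgebra.IsCocomm k C] {e : C}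
    (he : IsGroupLikeElem k e) {a b : WithConv (C →ₗ[k] A)} (ha : a e = 0) (hb : b e = 0)
    {n N : ℕ} (hN : n < N) {x : C} (hx : x ∈ primFiltration k e n) :
    convExpSum (a + b) N x = (convExpSum a N * convExpSum b N) x := by
  -- Both sides are sums of `aⁱ bʲ / (i! j!)`, over `i + j < N` on the left and over `i, j < N` on the
  -- right; the additional terms vanish at `x`.
  have hterm : ∀ m, (m.factorial : k)⁻¹ • (a + b) ^ m = ∑ i ∈ Finset.range (m + 1),
      ((i.factorial : k)⁻¹ * ((m - i).factorial : k)⁻¹) • (a ^ i * b ^ (m - i)) := by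
    intro m
    rw [(Commute.all a b).add_pow', Finset.smul_sum,
      Finset.Nat.sum_antidiagonal_eq_sum_range_succ_mk]
    refine Finset.sum_congr rfl fun i hi => ?_
    have him : i ≤ m := by simpa [Nat.lt_succ_iff] using hi
    rw [← Nat.cast_smul_eq_nsmul k, smul_smul]
    congr 1
    have h1 := Nat.choose_mul_factorial_mul_factorial him
    have h2 : (m.factorial : k) ≠ 0 := Nat.cast_ne_zero.mpr m.factorial_ne_zero
    have h3 : (i.factorial : k) ≠ 0 := Nat.cast_ne_zero.mpr i.factorial_ne_zero
    have h4 : ((m - i).factorial : k) ≠ 0 := Nat.cast_ne_zero.mpr (m - i).factorial_ne_zero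
    field_simp
    rw [← h1]
    push_cast
    ring
  have hL : convExpSum (a + b) N = ∑ i ∈ Finset.range N, ∑ j ∈ Finset.range (N - i),
      ((i.factorial : k)⁻¹ * (j.factorial : k)⁻¹) • (a ^ i * b ^ j) := by
    rw [convExpSum, Finset.sum_congr rfl fun m _ => hterm m]
    exact Finset.sum_range_diag_flip N fun i j =>
      ((i.factorial : k)⁻¹ * (j.factorial : k)⁻¹) • (a ^ i * b ^ j)
  have hR : convExpSum a N * convExpSum b N = ∑ i ∈ Finset.range N, ∑ j ∈ Finset.range N,
      ((i.factorial : k)⁻¹ * (j.factorial : k)⁻¹) • (a ^ i * b ^ j) := by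
    rw [convExpSum, convExpSum, Finset.sum_mul_sum]
    exact Finset.sum_congr rfl fun i _ => Finset.sum_congr rfl fun j _ => smul_mul_smul_comm _ _ _ _
  rw [hL, hR, WithConv.ofConv_sum, WithConv.ofConv_sum, LinearMap.sum_apply, LinearMap.sum_apply]
  refine Finset.sum_congr rfl fun i _ => ?_
  rw [WithConv.ofConv_sum, WithConv.ofConv_sum, LinearMap.sum_apply, LinearMap.sum_apply]
  refine Finset.sum_subset (Finset.range_mono (Nat.sub_le _ _)) fun j _ hj => ?_
  have hj' : N - i ≤ j := by simpa using hj
  rw [WithConv.ofConv_smul, LinearMap.smul_apply,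
    convPow_mul_convPow_apply_eq_zero he ha hb (by omega) hx, smul_zero]

variable [IsConilpotent k C]

/-- The exponential `∑ aⁿ / n!` in the convolution algebra of linear maps from a conilpotent
coalgebra, for `a` vanishing at the coaugmentation: at each element of the coalgebra the series has
only finitely many nonzero terms. -/
def convExp (a : WithConv (C →ₗ[k] A)) (ha : a (coaug k C) = 0) : WithConv (C →ₗ[k] A) :=
  WithConv.toConv
    { toFun := fun x => convExpSum a ((coaug_exhausts k C x).choose + 1) x
      map_add' := fun x y => by
        have he := coaug_isGroupLike k C
        have hx := (coaug_exhausts k C x).choose_spec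
        have hy := (coaug_exhausts k C y).choose_spec
        have hxy := (coaug_exhausts k C (x + y)).choose_spec
        have hx' := primFiltration_mono he
          (le_max_left _ (coaug_exhausts k C y).choose) hx
        have hy' := primFiltration_mono he
          (le_max_right (coaug_exhausts k C x).choose _) hy
        rw [convExpSum_apply_congr he ha (Nat.lt_succ_self _) (Nat.lt_succ_self _) hx hx',
          convExpSum_apply_congr he ha (Nat.lt_succ_self _) (Nat.lt_succ_self _) hy hy',
          convExpSum_apply_congr he ha (Nat.lt_succ_self _) (Nat.lt_succ_self _) hxy
            (add_mem hx' hy'), map_add]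
      map_smul' := fun c x => by
        have hx := (coaug_exhausts k C x).choose_spec
        rw [convExpSum_apply_congr (coaug_isGroupLike k C) ha (Nat.lt_succ_self _)
          (Nat.lt_succ_self _) (coaug_exhausts k C (c • x)).choose_spec
          (Submodule.smul_mem _ c hx), map_smul, RingHom.id_apply] }

theorem convExp_apply {a : WithConv (C →ₗ[k] A)} (ha : a (coaug k C) = 0) {n N : ℕ} (hN : n < N)
    {x : C} (hx : x ∈ primFiltration k (coaug k C) n) : convExp a ha x = convExpSum a N x :=
  convExpSum_apply_congr (coaug_isGroupLike k C) ha (Nat.lt_succ_self _) hN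
    (coaug_exhausts k C x).choose_spec hx

theorem convExp_zero : convExp (0 : WithConv (C →ₗ[k] A)) rfl = 1 := by
  ext x
  obtain ⟨n, hn⟩ := coaug_exhausts k C x
  rw [convExp_apply rfl (Nat.lt_succ_self n) hn, convExpSum_apply, Finset.sum_range_succ',
    Finset.sum_eq_zero fun i _ => by rw [pow_succ, mul_zero]; simp]
  simp

/-- The functional equation of the exponential; commutativity of the convolution product comes from
the cocommutativity of the coalgebra. -/
theorem convExp_add [CharZero k] [Coalgebra.IsCocomm k C] {a b : WithConv (C →ₗ[k] A)}
    (ha : a (coaug k C) = 0) (hb : b (coaug k C) = 0) (hab : (a + b) (coaug k C) = 0) :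
    convExp (a + b) hab = convExp a ha * convExp b hb := by
  ext x
  have he := coaug_isGroupLike k C
  obtain ⟨n, hn⟩ := coaug_exhausts k C x
  rw [convExp_apply hab (Nat.lt_succ_self n) hn,
    convExpSum_add_apply he ha hb (Nat.lt_succ_self n) hn]
  have h1 : ∀ y ∈ primFiltration k (coaug k C) n, (convExp a ha - convExpSum a (n + 1)) y = 0 :=
    fun y hy => sub_eq_zero.mpr (convExp_apply ha (Nat.lt_succ_self n) hy)
  have h2 : ∀ y ∈ primFiltration k (coaug k C) n, (convExp b hb - convExpSum b (n + 1)) y = 0 :=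
    fun y hy => sub_eq_zero.mpr (convExp_apply hb (Nat.lt_succ_self n) hy)
  have h3 : convExp a ha * convExp b hb = convExpSum a (n + 1) * convExpSum b (n + 1) +
      (convExp a ha * (convExp b hb - convExpSum b (n + 1)) +
        convExpSum b (n + 1) * (convExp a ha - convExpSum a (n + 1))) := by ring
  rw [h3, WithConv.ofConv_add, LinearMap.add_apply, WithConv.ofConv_add, LinearMap.add_apply,
    convMul_vanishing he _ h2 x hn, convMul_vanishing he _ h1 x hn, add_zero, add_zero]

theorem algHom_comp_convExp {B : Type*} [CommRing B] [Algebra k B] (h : A →ₐ[k] B)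
    {a : WithConv (C →ₗ[k] A)} (ha : a (coaug k C) = 0)
    (hb : WithConv.toConv (h.toLinearMap ∘ₗ a.ofConv) (coaug k C) = 0) :
    WithConv.toConv (h.toLinearMap ∘ₗ (convExp a ha).ofConv) =
      convExp (WithConv.toConv (h.toLinearMap ∘ₗ a.ofConv)) hb := by
  ext x
  obtain ⟨n, hn⟩ := coaug_exhausts k C x
  rw [convExp_apply hb (Nat.lt_succ_self n) hn]
  change h (convExp a ha x) = _
  rw [convExp_apply ha (Nat.lt_succ_self n) hn, convExpSum_apply, convExpSum_apply, map_sum]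
  refine Finset.sum_congr rfl fun i _ => ?_
  rw [map_smul, ← algHom_comp_convPow]
  rfl

theorem convExp_comp_coalgHom {B : Type*} [AddCommGroup B] [Module k B] [Coalgebra k B]
    [IsConilpotent k B] (g : B →ₗc[k] C) {a : WithConv (C →ₗ[k] A)} (ha : a (coaug k C) = 0)
    (hb : WithConv.toConv (a.ofConv ∘ₗ g.toLinearMap) (coaug k B) = 0) :
    WithConv.toConv ((convExp a ha).ofConv ∘ₗ g.toLinearMap) =
      convExp (WithConv.toConv (a.ofConv ∘ₗ g.toLinearMap)) hb := by
  ext x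
  obtain ⟨n, hn⟩ := coaug_exhausts k B x
  obtain ⟨m, hm⟩ := coaug_exhausts k C (g x)
  rw [convExp_apply hb (Nat.lt_succ_of_le (le_max_left n m)) hn]
  change convExp a ha (g x) = _
  rw [convExp_apply ha (Nat.lt_succ_of_le (le_max_right n m)) hm, convExpSum_apply,
    convExpSum_apply]
  refine Finset.sum_congr rfl fun i _ => ?_
  rw [← convPow_comp_coalgHom]
  rfl

end Convolution

section Primitives

variable {k : Type u} [Field k] {C : Type v} [AddCommGroup C] [Module k C] [Coalgebra k C]
  [IsConilpotent k C]

theorem mem_primitives {x : C} : x ∈ primitives k C ↔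
    Coalgebra.comul (R := k) x = x ⊗ₜ[k] coaug k C + coaug k C ⊗ₜ[k] x :=
  Iff.rfl

theorem mem_primitives_iff_reducedComul {x : C} :
    x ∈ primitives k C ↔ reducedComul k (coaug k C) x = 0 := by
  rw [mem_primitives, reducedComul_apply, sub_sub, sub_eq_zero]

theorem counit_primitive {x : C} (hx : x ∈ primitives k C) :
    Coalgebra.counit (R := k) x = 0 := by
  have h := Coalgebra.rTensor_counit_comul (R := k) x
  rw [mem_primitives.mp hx] at h
  have h2 := congrArg (TensorProduct.lid k C) h
  simp only [map_add, LinearMap.rTensor_tmul, TensorProduct.lid_tmul, one_smul,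
    (coaug_isGroupLike k C).counit_eq_one, add_eq_right] at h2
  simpa [(coaug_isGroupLike k C).counit_eq_one] using congrArg (Coalgebra.counit (R := k)) h2

theorem convExp_apply_primitive {A : Type w} [CommRing A] [Algebra k A]
    {a : WithConv (C →ₗ[k] A)} (ha : a (coaug k C) = 0) {x : C} (hx : x ∈ primitives k C) :
    convExp a ha x = a x := by
  have hx1 : x ∈ primFiltration k (coaug k C) 1 := by
    rw [mem_primFiltration_succ, mem_primitives_iff_reducedComul.mp hx]
    exact zero_mem _
  rw [convExp_apply ha (Nat.lt_succ_self 1) hx1, convExpSum_apply]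
  simp [Finset.sum_range_succ, counit_primitive hx]

/-- A morphism out of a conilpotent coalgebra is injective if it is injective on primitives. -/
theorem injective_of_injective_on_primitives {D : Type w} [AddCommGroup D] [Module k D]
    [Coalgebra k D] (f : C →ₗc[k] D) (hf : ∀ x ∈ primitives k C, f x = 0 → x = 0) :
    Function.Injective f := by
  have key : ∀ (n : ℕ) (x : C), x ∈ primFiltration k (coaug k C) n → f x = 0 → x = 0 := by
    intro n
    induction n with
    | zero =>
      intro x hx h
      obtain ⟨c, rfl⟩ := mem_primFiltration_zero.mp hx
      have h1 := congrArg (Coalgebra.counit (R := k)) h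
      rw [CoalgHomClass.counit_comp_apply] at h1
      simp [(coaug_isGroupLike k C).counit_eq_one] at h1
      rw [h1, zero_smul]
    | succ n ih =>
      intro x hx h
      refine hf x ?_ h
      rw [mem_primitives_iff_reducedComul]
      obtain ⟨t, ht⟩ := mem_primFiltration_succ.mp hx
      have hinj : Function.Injective
          (f.toLinearMap ∘ₗ (primFiltration k (coaug k C) n).subtype) := by
        rw [← LinearMap.ker_eq_bot, LinearMap.ker_eq_bot']
        exact fun y hy => Subtype.ext (ih y y.2 hy)
      have h0 : TensorProduct.map (f.toLinearMap ∘ₗ (primFiltration k (coaug k C) n).subtype)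
          (f.toLinearMap ∘ₗ (primFiltration k (coaug k C) n).subtype) t = 0 := by
        rw [TensorProduct.map_comp]
        change TensorProduct.map _ _ (TensorProduct.mapIncl _ _ t) = 0
        rw [ht, ← reducedComul_map, h, map_zero]
      have ht0 : t = 0 := by
        exact TensorProduct.map_injective_of_flat_flat _ _ hinj hinj (h0.trans (map_zero _).symm)
      rw [← ht, ht0, map_zero]
  intro x y hxy
  obtain ⟨n, hn⟩ := coaug_exhausts k C (x - y)
  exact sub_eq_zero.mp (key n _ hn (by rw [map_sub, hxy, sub_self]))

end Primitives

/-! ### Surjectivity of morphisms out of formal manifolds -/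

section CommutativeAlgebra

theorem pow_succ_le_of_mul_le {R : Type*} [CommRing R] {m : Ideal R} {I : ℕ → Ideal R}
    (h0 : m ≤ I 0) (h : ∀ n, m * I n ≤ I (n + 1)) (n : ℕ) : m ^ (n + 1) ≤ I n := by
  induction n with
  | zero => simpa using h0
  | succ n ih =>
    rw [pow_succ']
    exact (Ideal.mul_mono_right ih).trans (h n)

/-- Two ring maps `p` and `ψ` which agree modulo the image of an ideal `I ≤ m` with `p (m * I) = 0`
agree on `m ^ 2`, because `ψ (a b) - p (a b) = (ψ a - p a) ψ b + p a (ψ b - p b)`. -/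
theorem eqOn_sq_of_sub_mem_map {R A : Type*} [CommRing R] [CommRing A] (p ψ : R →+* A) (m I : Ideal R)
    (hI : I ≤ m) (hmI : m * I ≤ RingHom.ker p) (h : ∀ a, ψ a - p a ∈ I.map p) :
    ∀ a ∈ m ^ 2, ψ a = p a := by
  have h0 : m.map p * I.map p = ⊥ := by
    rw [← Ideal.map_mul, Ideal.map_eq_bot_iff_le_ker]
    exact hmI
  have hmul : ∀ x ∈ m.map p, ∀ y ∈ I.map p, x * y = 0 := fun x hx y hy => by
    have := Ideal.mul_mem_mul hx hy
    rwa [h0] at this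
  intro a ha
  rw [pow_two] at ha
  induction ha using Submodule.mul_induction_on' with
  | mem_mul_mem a ha b hb =>
    have hb' : ψ b ∈ m.map p := by
      have := add_mem (Ideal.map_mono hI (h b)) (Ideal.mem_map_of_mem p hb)
      rwa [sub_add_cancel] at this
    have e1 := hmul _ hb' _ (h a)
    have e2 := hmul _ (Ideal.mem_map_of_mem p ha) _ (h b)
    rw [map_mul, map_mul]
    linear_combination e1 + e2
  | add a _ b _ ha hb => rw [map_add, map_add, ha, hb]

/-- Let `σ : R → S` be surjective with kernel contained in an open ideal `I`. If `S` is formally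
smooth over `B`, the map `S → R ⧸ I` lifts to `R ⧸ I'`, where `m * I ≤ I'`, and the composite of the
lift with `σ` agrees with the reduction on `m ^ 2`. So the part of the kernel of `σ` which lies in
`m ^ 2` is contained in `I'`. -/
theorem mem_of_formallySmoothAdic {B R S : Type u} [CommRing B] [CommRing R] [CommRing S]
    (β : B →+* R) (σ : R →+* S) (hσ : Function.Surjective σ) {m I I' : Ideal R} {n : Ideal S}
    (hI : I ≤ m) (hmI : m * I ≤ I') (hker : RingHom.ker σ ≤ I) (hm : ∃ N : ℕ, m ^ N ≤ I)
    (hn : n ≤ m.map σ) (hS : FormallySmoothAdic (σ.comp β) n) {a : R} (ha : a ∈ m ^ 2)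
    (hσa : σ a = 0) : a ∈ I' := by
  let p := Ideal.Quotient.mk I'
  let J := I.map p
  let q := (Ideal.Quotient.mk J).comp p
  have hmI' : m * I ≤ RingHom.ker p := by
    rw [Ideal.mk_ker]
    exact hmI
  have hJ : J ^ 2 = ⊥ := by
    rw [pow_two, ← Ideal.map_mul, Ideal.map_eq_bot_iff_le_ker]
    exact (Ideal.mul_mono_left hI).trans hmI'
  have hq : I ≤ RingHom.ker q := fun a ha =>
    Ideal.Quotient.eq_zero_iff_mem.mpr (Ideal.mem_map_of_mem p ha)
  let h : S →+* (R ⧸ I') ⧸ J := RingHom.liftOfSurjective σ hσ ⟨q, hker.trans hq⟩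
  have hh : h.comp σ = q := RingHom.liftOfSurjective_comp _ _ _
  obtain ⟨N, hN⟩ := hm
  have hcont : n ^ N ≤ RingHom.ker h := by
    refine (Ideal.pow_right_mono hn _).trans ?_
    rw [← Ideal.map_pow, Ideal.map_le_iff_le_comap, RingHom.comap_ker, hh]
    exact hN.trans hq
  obtain ⟨l, hl, -⟩ := hS _ J hJ (p.comp β) h ⟨N, hcont⟩ (by rw [← RingHom.comp_assoc, hh]; rfl)
  have hψ : ∀ b, (l.comp σ) b - p b ∈ J := by
    intro b
    rw [← Ideal.Quotient.eq_zero_iff_mem, map_sub, sub_eq_zero]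
    exact (RingHom.congr_fun hl (σ b)).trans (RingHom.congr_fun hh b)
  have h3 := eqOn_sq_of_sub_mem_map p (l.comp σ) m I hI hmI' hψ a ha
  rw [RingHom.comp_apply, hσa, map_zero] at h3
  exact Ideal.Quotient.eq_zero_iff_mem.mp h3.symm

end CommutativeAlgebra

section Surjectivity

variable {k : Type u} [Field k]

section
variable {D : Type v} [AddCommGroup D] [Module k D] [Coalgebra k D]
  [IsConilpotent k D] [Coalgebra.IsCocomm k D]

variable (k D) in
/-- The ideal of functions which vanish on the `n`-th step of the primitive filtration. -/
def vanishingIdeal (n : ℕ) : Ideal (FunctionAlgebra k D) where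
  carrier := {φ | ∀ x ∈ primFiltration k (coaug k D) n, φ x = 0}
  zero_mem' _ _ := rfl
  add_mem' {φ ψ} hφ hψ x hx := by
    change φ x + ψ x = 0
    rw [hφ x hx, hψ x hx, add_zero]
  smul_mem' φ _ hψ := convMul_vanishing (coaug_isGroupLike k D) φ hψ

theorem mem_maxIdeal {φ : FunctionAlgebra k D} : φ ∈ maxIdeal k D ↔ φ (coaug k D) = 0 :=
  Iff.rfl

theorem vanishingIdeal_le_maxIdeal (n : ℕ) : vanishingIdeal k D n ≤ maxIdeal k D :=
  fun _ h => h _ (self_mem_primFiltration (coaug_isGroupLike k D) n)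

theorem maxIdeal_le_vanishingIdeal_zero : maxIdeal k D ≤ vanishingIdeal k D 0 := by
  intro φ hφ x hx
  obtain ⟨c, rfl⟩ := mem_primFiltration_zero.mp hx
  rw [map_smul, mem_maxIdeal.mp hφ, smul_zero]

theorem maxIdeal_mul_vanishingIdeal_le (n : ℕ) :
    maxIdeal k D * vanishingIdeal k D n ≤ vanishingIdeal k D (n + 1) := by
  rw [Ideal.mul_le]
  intro φ hφ ψ hψ x hx
  rw [convMul_apply_of_vanishing (coaug_isGroupLike k D) φ hψ hx, mem_maxIdeal.mp hφ, zero_mul]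

end

theorem dualMap_surjective {C D : Type v} [AddCommGroup C] [Module k C] [Coalgebra k C]
    [AddCommGroup D] [Module k D] [Coalgebra k D] (f : C →ₗc[k] D) (hf : Function.Injective f) :
    Function.Surjective (dualMap k f) := by
  intro ψ
  obtain ⟨s, hs⟩ := f.toLinearMap.exists_leftInverse_of_injective (LinearMap.ker_eq_bot.mpr hf)
  refine ⟨WithConv.toConv (ψ.ofConv ∘ₗ s), WithConv.ofConv_injective ?_⟩
  change (ψ.ofConv ∘ₗ s) ∘ₗ f.toLinearMap = _
  rw [LinearMap.comp_assoc, hs, LinearMap.comp_id]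

/-- An injective morphism `f` from a formal manifold `C` is surjective if every function on `D` which
vanishes on the image of `f` lies in the square of the maximal ideal. By induction on `n`, such
functions vanish on the whole `n`-th step of the primitive filtration of `D`, so the image of `f`
contains that step. -/
theorem surjective_of_isFormalSubmersion_counit {C D : Type u}
    [AddCommGroup C] [Module k C] [Coalgebra k C] [IsConilpotent k C] [Coalgebra.IsCocomm k C]
    [AddCommGroup D] [Module k D] [Coalgebra k D] [IsConilpotent k D] [Coalgebra.IsCocomm k D]
    (hC : IsFormalSubmersion k (Coalgebra.counitCoalgHom k C))
    (f : C →ₗc[k] D) (hf : Function.Injective f)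
    (hker : ∀ φ : FunctionAlgebra k D, dualMap k f φ = 0 → φ ∈ maxIdeal k D ^ 2) :
    Function.Surjective f := by
  have hsurj := dualMap_surjective f hf
  have key : ∀ n φ, dualMap k f φ = 0 → φ ∈ vanishingIdeal k D n := by
    intro n
    induction n with
    | zero =>
      exact fun φ hφ => maxIdeal_le_vanishingIdeal_zero (Ideal.pow_le_self two_ne_zero (hker φ hφ))
    | succ n ih =>
      intro φ hφ
      have hle : maxIdeal k C ≤ (maxIdeal k D).map (dualMap k f) := by
        intro ψ hψ
        obtain ⟨φ, rfl⟩ := hsurj ψ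
        refine Ideal.mem_map_of_mem _ ?_
        rw [mem_maxIdeal, ← map_coaug k f]
        exact hψ
      have hcounit : (dualMap k f).comp (dualMap k (Coalgebra.counitCoalgHom k D)) =
          dualMap k (Coalgebra.counitCoalgHom k C) := by
        ext φ x
        change φ.ofConv (Coalgebra.counit (f x)) = φ.ofConv (Coalgebra.counit x)
        rw [CoalgHomClass.counit_comp_apply]
      have hS : FormallySmoothAdic
          ((dualMap k f).comp (dualMap k (Coalgebra.counitCoalgHom k D))) (maxIdeal k C) := by
        rw [hcounit]
        exact hC
      have hm : ∃ N : ℕ, maxIdeal k D ^ N ≤ vanishingIdeal k D n :=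
        ⟨n + 1, pow_succ_le_of_mul_le (m := maxIdeal k D) (I := vanishingIdeal k D)
          maxIdeal_le_vanishingIdeal_zero
          maxIdeal_mul_vanishingIdeal_le n⟩
      exact mem_of_formallySmoothAdic _ (dualMap k f) hsurj (vanishingIdeal_le_maxIdeal n)
        (maxIdeal_mul_vanishingIdeal_le n) ih hm hle hS (hker φ hφ) hφ
  intro y
  by_contra hy
  obtain ⟨φ, hφ, hle⟩ := Submodule.exists_le_ker_of_notMem (p := LinearMap.range f.toLinearMap) hy
  obtain ⟨n, hn⟩ := coaug_exhausts k D y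
  refine hφ (key n (WithConv.toConv φ) ?_ y hn)
  ext x
  exact hle ⟨x, rfl⟩

end Surjectivity

/-! ### The symmetric coalgebra and the exponential coordinates -/

section SymmetricCoalgebra

variable {k : Type u} [Field k] {V : Type v} [AddCommGroup V] [Module k V]

open SymmetricAlgebra

theorem isGroupLikeElem_one_symmetricAlgebra : IsGroupLikeElem k (1 : SymmetricAlgebra k V) :=
  ⟨by simp, by simp [Algebra.TensorProduct.one_def]⟩

theorem reducedComul_ι (v : V) : reducedComul k (1 : SymmetricAlgebra k V) (ι k V v) = 0 := by
  rw [reducedComul_apply, comul_ι]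
  abel

theorem ι_mem_primFiltration_one (v : V) :
    ι k V v ∈ primFiltration k (1 : SymmetricAlgebra k V) 1 := by
  rw [mem_primFiltration_succ, reducedComul_ι]
  exact zero_mem _

/-- Multiplication by a generator raises the primitive filtration by one, since
`Δ (v x) = (v ⊗ 1 + 1 ⊗ v) Δ x`. -/
theorem ι_mul_mem_primFiltration (v : V) (n : ℕ) :
    ∀ x ∈ primFiltration k (1 : SymmetricAlgebra k V) n,
      ι k V v * x ∈ primFiltration k (1 : SymmetricAlgebra k V) (n + 1) := by
  have he : IsGroupLikeElem k (1 : SymmetricAlgebra k V) := isGroupLikeElem_one_symmetricAlgebra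
  induction n with
  | zero =>
    intro x hx
    obtain ⟨c, rfl⟩ := mem_primFiltration_zero.mp hx
    rw [mul_smul_comm, mul_one]
    exact Submodule.smul_mem _ _ (ι_mem_primFiltration_one v)
  | succ n ih =>
    intro x hx
    have hv : ι k V v ∈ primFiltration k (1 : SymmetricAlgebra k V) (n + 1) :=
      primFiltration_mono he (by omega) (ι_mem_primFiltration_one v)
    obtain ⟨t, ht⟩ := mem_primFiltration_succ.mp hx
    rw [mem_primFiltration_succ]
    have h1 : ∀ s, (ι k V v ⊗ₜ[k] 1 + 1 ⊗ₜ[k] ι k V v) * TensorProduct.mapIncl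
        (primFiltration k (1 : SymmetricAlgebra k V) n) (primFiltration k 1 n) s ∈
        LinearMap.range (TensorProduct.mapIncl (primFiltration k (1 : SymmetricAlgebra k V) (n + 1))
          (primFiltration k 1 (n + 1))) := by
      intro s
      induction s with
      | zero => rw [map_zero, mul_zero]; exact zero_mem _
      | add a b ha hb => rw [map_add, mul_add]; exact add_mem ha hb
      | tmul a b =>
        have e : TensorProduct.mapIncl (primFiltration k (1 : SymmetricAlgebra k V) n)
            (primFiltration k 1 n) (a ⊗ₜ b) =
            (a : SymmetricAlgebra k V) ⊗ₜ[k] (b : SymmetricAlgebra k V) := rfl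
        rw [e, add_mul, Algebra.TensorProduct.tmul_mul_tmul, Algebra.TensorProduct.tmul_mul_tmul,
          one_mul, one_mul]
        exact add_mem
          (tmul_mem_range_mapIncl (ih a a.2) (primFiltration_le_succ he n b.2))
          (tmul_mem_range_mapIncl (primFiltration_le_succ he n a.2) (ih b b.2))
    have h2 : reducedComul k 1 (ι k V v * x) = ι k V v ⊗ₜ[k] x + x ⊗ₜ[k] ι k V v +
        (ι k V v ⊗ₜ[k] 1 + 1 ⊗ₜ[k] ι k V v) * reducedComul k 1 x := by
      simp only [reducedComul_apply, Bialgebra.comul_mul, comul_ι, mul_sub, add_mul,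
        Algebra.TensorProduct.tmul_mul_tmul, one_mul, mul_one]
      abel
    rw [h2, ← ht]
    exact add_mem (add_mem (tmul_mem_range_mapIncl hv hx) (tmul_mem_range_mapIncl hx hv)) (h1 t)

theorem exists_mem_primFiltration_symmetricAlgebra (x : SymmetricAlgebra k V) :
    ∃ n, x ∈ primFiltration k (1 : SymmetricAlgebra k V) n := by
  have he : IsGroupLikeElem k (1 : SymmetricAlgebra k V) := isGroupLikeElem_one_symmetricAlgebra
  -- Multiplying by `x` preserves the union of the filtration; this property is stable under products.
  have key : ∀ y n, y ∈ primFiltration k (1 : SymmetricAlgebra k V) n →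
      ∃ m, x * y ∈ primFiltration k (1 : SymmetricAlgebra k V) m := by
    induction x using SymmetricAlgebra.induction with
    | algebraMap c =>
      intro y n hy
      exact ⟨n, by rw [← Algebra.smul_def]; exact Submodule.smul_mem _ c hy⟩
    | ι v => exact fun y n hy => ⟨n + 1, ι_mul_mem_primFiltration v n y hy⟩
    | mul a b ha hb =>
      intro y n hy
      obtain ⟨m, hm⟩ := hb y n hy
      rw [mul_assoc]
      exact ha _ m hm
    | add a b ha hb =>
      intro y n hy
      obtain ⟨m, hm⟩ := ha y n hy
      obtain ⟨m', hm'⟩ := hb y n hy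
      rw [add_mul]
      exact ⟨max m m', add_mem (primFiltration_mono he (le_max_left _ _) hm)
        (primFiltration_mono he (le_max_right _ _) hm')⟩
  simpa using key 1 0 (self_mem_primFiltration he 0)

instance : IsConilpotent k (SymmetricAlgebra k V) :=
  ⟨1, isGroupLikeElem_one_symmetricAlgebra, exists_mem_primFiltration_symmetricAlgebra⟩

theorem coaug_symmetricAlgebra : coaug k (SymmetricAlgebra k V) = 1 :=
  (groupLike_unique k (coaug_isGroupLike k _) (coaug_exhausts k _)
    isGroupLikeElem_one_symmetricAlgebra).symm

/-- The linear functional on the symmetric algebra which extends `ξ` by zero in all degrees other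
than one. It is the `ε`-component of the algebra map `v ↦ ξ v ε` to the dual numbers. -/
def linearCoordinate (ξ : V →ₗ[k] k) : SymmetricAlgebra k V →ₗ[k] k :=
  TrivSqZeroExt.sndHom k k ∘ₗ (lift (TrivSqZeroExt.inrHom k k ∘ₗ ξ)).toLinearMap

theorem fst_lift_inr (ξ : V →ₗ[k] k) (x : SymmetricAlgebra k V) :
    (lift (TrivSqZeroExt.inrHom k k ∘ₗ ξ) x).fst = Coalgebra.counit (R := k) x := by
  have h : (TrivSqZeroExt.fstHom k k k).comp (lift (TrivSqZeroExt.inrHom k k ∘ₗ ξ)) =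
      Bialgebra.counitAlgHom k (SymmetricAlgebra k V) := by
    ext v
    simp [algebraMapInv_ι]
  exact DFunLike.congr_fun h x

theorem linearCoordinate_one (ξ : V →ₗ[k] k) : linearCoordinate ξ 1 = 0 := by
  simp [linearCoordinate]

theorem linearCoordinate_ι (ξ : V →ₗ[k] k) (v : V) : linearCoordinate ξ (ι k V v) = ξ v := by
  simp [linearCoordinate]

theorem linearCoordinate_ι_mul (ξ : V →ₗ[k] k) (v : V) (x : SymmetricAlgebra k V) :
    linearCoordinate ξ (ι k V v * x) = ξ v * Coalgebra.counit (R := k) x := by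
  rw [← fst_lift_inr ξ x]
  simp [linearCoordinate, mul_comm]

theorem symmetricAlgebra_ι_injective : Function.Injective (ι k V) := by
  rw [← LinearMap.ker_eq_bot, LinearMap.ker_eq_bot']
  intro v hv
  rw [← Module.forall_dual_apply_eq_zero_iff k]
  intro ξ
  rw [← linearCoordinate_ι, hv, map_zero]

/-- The contraction by `ξ`, i.e. the derivation of the symmetric algebra which extends `ξ`. -/
def contraction (ξ : V →ₗ[k] k) : SymmetricAlgebra k V →ₗ[k] SymmetricAlgebra k V :=
  (TensorProduct.lid k _).toLinearMap ∘ₗ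
    TensorProduct.map (linearCoordinate ξ) LinearMap.id ∘ₗ Coalgebra.comul

theorem contraction_one (ξ : V →ₗ[k] k) : contraction ξ 1 = 0 := by
  simp [contraction, Algebra.TensorProduct.one_def, linearCoordinate_one]

theorem contraction_ι_mul (ξ : V →ₗ[k] k) (v : V) (x : SymmetricAlgebra k V) :
    contraction ξ (ι k V v * x) = ξ v • x + ι k V v * contraction ξ x := by
  have h1 : ∀ t : SymmetricAlgebra k V ⊗[k] SymmetricAlgebra k V,
      TensorProduct.lid k _ (TensorProduct.map (linearCoordinate ξ) LinearMap.id
        ((ι k V v ⊗ₜ[k] 1 + 1 ⊗ₜ[k] ι k V v) * t)) =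
      ξ v • TensorProduct.lid k _ (LinearMap.rTensor _ Coalgebra.counit t) +
        ι k V v * TensorProduct.lid k _
          (TensorProduct.map (linearCoordinate ξ) LinearMap.id t) := by
    intro t
    induction t with
    | zero => simp
    | add a b ha hb =>
      rw [mul_add, map_add, map_add, ha, hb]
      simp only [map_add, smul_add, mul_add]
      abel
    | tmul a b => simp [add_mul, linearCoordinate_ι_mul, mul_smul]
  have h2 := h1 (Coalgebra.comul (R := k) x)
  rw [Coalgebra.rTensor_counit_comul, TensorProduct.lid_tmul, one_smul, ← comul_ι,
    ← Bialgebra.comul_mul] at h2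
  exact h2

/-- Convolution with a linear coordinate is dual to contraction. -/
theorem linearCoordinate_convMul_apply (ξ : V →ₗ[k] k)
    (ψ : FunctionAlgebra k (SymmetricAlgebra k V)) (x : SymmetricAlgebra k V) :
    (WithConv.toConv (linearCoordinate ξ) * ψ) x = ψ (contraction ξ x) := by
  have h : LinearMap.mul' k k ∘ₗ TensorProduct.map (linearCoordinate ξ) ψ.ofConv =
      ψ.ofConv ∘ₗ (TensorProduct.lid k _).toLinearMap ∘ₗ
        TensorProduct.map (linearCoordinate ξ) LinearMap.id := by
    ext a b
    simp
  exact LinearMap.congr_fun h (Coalgebra.comul x)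

section Euler

variable [Module.Finite k V]

variable (k V) in
/-- The Euler operator `∑ eᵢ ∂ᵢ`, which multiplies the elements of degree `n` by `n`. -/
def euler : SymmetricAlgebra k V →ₗ[k] SymmetricAlgebra k V :=
  ∑ i, LinearMap.mulLeft k (ι k V (Module.finBasis k V i)) ∘ₗ
    contraction ((Module.finBasis k V).coord i)

theorem euler_apply (x : SymmetricAlgebra k V) : euler k V x =
    ∑ i, ι k V (Module.finBasis k V i) * contraction ((Module.finBasis k V).coord i) x := by
  simp [euler, LinearMap.sum_apply]

theorem euler_one : euler k V 1 = 0 := by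
  simp [euler_apply, contraction_one]

theorem euler_ι_mul (v : V) (x : SymmetricAlgebra k V) :
    euler k V (ι k V v * x) = ι k V v * (x + euler k V x) := by
  have h : ι k V v = ∑ i, (Module.finBasis k V).coord i v • ι k V (Module.finBasis k V i) := by
    conv_lhs => rw [← (Module.finBasis k V).sum_repr v, map_sum]
    simp
  rw [mul_add, euler_apply, euler_apply, Finset.mul_sum]
  conv_rhs => lhs; rw [h, Finset.sum_mul]
  rw [← Finset.sum_add_distrib]
  refine Finset.sum_congr rfl fun i _ => ?_
  rw [contraction_ι_mul, mul_add, mul_smul_comm, smul_mul_assoc, mul_left_comm]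

theorem euler_ι (v : V) : euler k V (ι k V v) = ι k V v := by
  simpa [euler_one] using euler_ι_mul v (1 : SymmetricAlgebra k V)

/-- The symmetric algebra is spanned by `1` and by eigenvectors of the Euler operator with positive
integral eigenvalue. -/
theorem span_one_sup_iSup_eigenspace_euler :
    k ∙ (1 : SymmetricAlgebra k V) ⊔
      ⨆ n : ℕ, Module.End.eigenspace (euler k V) ((n : k) + 1) = ⊤ := by
  set T := k ∙ (1 : SymmetricAlgebra k V) ⊔
    ⨆ n : ℕ, Module.End.eigenspace (euler k V) ((n : k) + 1) with hT
  have hmem : ∀ (n : ℕ) x, euler k V x = ((n : k) + 1) • x → x ∈ T := fun n x hx =>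
    Submodule.mem_sup_right (Submodule.mem_iSup_of_mem n (Module.End.mem_eigenspace_iff.mpr hx))
  have hι : ∀ v, T ≤ T.comap (LinearMap.mulLeft k (ι k V v)) := by
    intro v
    refine sup_le ?_ (iSup_le fun n => ?_)
    · rw [Submodule.span_singleton_le_iff_mem]
      change ι k V v * 1 ∈ T
      rw [mul_one]
      exact hmem 0 _ (by rw [euler_ι]; simp)
    · intro x hx
      refine hmem (n + 1) _ ?_
      rw [Module.End.mem_eigenspace_iff] at hx
      rw [LinearMap.mulLeft_apply, euler_ι_mul, hx, ← mul_smul_comm]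
      push_cast
      congr 1
      module
  have hmul : ∀ a, T ≤ T.comap (LinearMap.mulLeft k a) := by
    intro a
    induction a using SymmetricAlgebra.induction with
    | algebraMap c =>
      intro x hx
      change algebraMap k _ c * x ∈ T
      rw [← Algebra.smul_def]
      exact T.smul_mem c hx
    | ι v => exact hι v
    | mul a b ha hb =>
      intro x hx
      change a * b * x ∈ T
      rw [mul_assoc]
      exact ha (hb hx)
    | add a b ha hb =>
      intro x hx
      change (a + b) * x ∈ T
      rw [add_mul]
      exact T.add_mem (ha hx) (hb hx)
  refine eq_top_iff.mpr fun x _ => ?_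
  have h1 : x * 1 ∈ T :=
    hmul x (Submodule.mem_sup_left (Submodule.mem_span_singleton_self _))
  rwa [mul_one] at h1

/-- In characteristic zero the Euler operator is injective off the constants. -/
theorem ker_euler_le [CharZero k] :
    LinearMap.ker (euler k V) ≤ k ∙ (1 : SymmetricAlgebra k V) := by
  intro x hx
  have hx0 : euler k V x = 0 := hx
  have htop : x ∈ k ∙ (1 : SymmetricAlgebra k V) ⊔
      ⨆ n : ℕ, Module.End.eigenspace (euler k V) ((n : k) + 1) := by
    rw [span_one_sup_iSup_eigenspace_euler]
    trivial
  obtain ⟨y, hy, z, hz, rfl⟩ := Submodule.mem_sup.mp htop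
  obtain ⟨c, rfl⟩ := Submodule.mem_span_singleton.mp hy
  have hz0 : z ∈ Module.End.eigenspace (euler k V) 0 := by
    rw [Module.End.mem_eigenspace_iff, zero_smul]
    simpa [euler_one] using hx0
  have hle : ⨆ n : ℕ, Module.End.eigenspace (euler k V) ((n : k) + 1) ≤
      ⨆ μ : k, ⨆ _ : μ ≠ 0, Module.End.eigenspace (euler k V) μ :=
    iSup_le fun n => le_iSup₂_of_le ((n : k) + 1) (Nat.cast_add_one_ne_zero n) le_rfl
  have h := Submodule.disjoint_def.mp (Module.End.eigenspaces_iSupIndep (euler k V) 0) z hz0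
    (hle hz)
  rw [h, add_zero]
  exact hy

/-- A functional `φ` on `Sym V` which vanishes in degrees zero and one factors as `φ' ∘ E` through
the Euler operator, hence is the sum of the convolution products of the coordinates with the
functionals `φ' (eᵢ * -)`. -/
theorem mem_maxIdeal_sq_of_vanishing [CharZero k] (φ : FunctionAlgebra k (SymmetricAlgebra k V))
    (h1 : φ 1 = 0) (hι : ∀ v, φ (ι k V v) = 0) : φ ∈ maxIdeal k (SymmetricAlgebra k V) ^ 2 := by
  have hmem : φ.ofConv ∈ LinearMap.range (euler k V).dualMap := by
    rw [LinearMap.range_dualMap_eq_dualAnnihilator_ker, Submodule.mem_dualAnnihilator]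
    intro x hx
    obtain ⟨c, rfl⟩ := Submodule.mem_span_singleton.mp (ker_euler_le hx)
    rw [map_smul, h1, smul_zero]
  obtain ⟨φ', hφ'⟩ := hmem
  have hφ'x : ∀ x, φ' (euler k V x) = φ x := fun x => LinearMap.congr_fun hφ' x
  have hsum : φ = ∑ i, WithConv.toConv (linearCoordinate ((Module.finBasis k V).coord i)) *
      WithConv.toConv (φ' ∘ₗ LinearMap.mulLeft k (ι k V (Module.finBasis k V i))) := by
    ext x
    rw [← hφ'x, euler_apply, map_sum, WithConv.ofConv_sum, LinearMap.sum_apply]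
    refine Finset.sum_congr rfl fun i _ => ?_
    rw [linearCoordinate_convMul_apply]
    rfl
  rw [hsum]
  refine sum_mem fun i _ => ?_
  rw [pow_two (maxIdeal k (SymmetricAlgebra k V))]
  refine Ideal.mul_mem_mul ?_ ?_
  · rw [mem_maxIdeal, coaug_symmetricAlgebra]
    exact linearCoordinate_one _
  · rw [mem_maxIdeal, coaug_symmetricAlgebra]
    change φ' (ι k V _ * 1) = 0
    rw [mul_one, ← euler_ι, hφ'x, hι]

end Euler

end SymmetricCoalgebra

section Exponential

variable {k : Type u} [Field k] {C : Type v} [AddCommGroup C] [Module k C]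
  [Coalgebra k C] [IsConilpotent k C]

section

variable {V : Type w} [AddCommGroup V] [Module k V]

theorem ι_comp_apply_coaug {r : C →ₗ[k] V} (hr : r (coaug k C) = 0) :
    WithConv.toConv (SymmetricAlgebra.ι k V ∘ₗ r) (coaug k C) = 0 := by
  change SymmetricAlgebra.ι k V (r (coaug k C)) = 0
  rw [hr, map_zero]

theorem counit_comp_convExp {r : C →ₗ[k] V} (hr : r (coaug k C) = 0) :
    Coalgebra.counit (R := k) ∘ₗ
      (convExp (WithConv.toConv (SymmetricAlgebra.ι k V ∘ₗ r)) (ι_comp_apply_coaug hr)).ofConv =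
    Coalgebra.counit (R := k) := by
  have h0 : WithConv.toConv ((Bialgebra.counitAlgHom k (SymmetricAlgebra k V)).toLinearMap ∘ₗ
      (SymmetricAlgebra.ι k V ∘ₗ r)) = 0 := by
    ext x
    simp [SymmetricAlgebra.algebraMapInv_ι]
  have h1 := algHom_comp_convExp (Bialgebra.counitAlgHom k (SymmetricAlgebra k V))
    (ι_comp_apply_coaug hr) (LinearMap.congr_fun (congrArg WithConv.ofConv h0) _)
  have h2 : WithConv.toConv ((Bialgebra.counitAlgHom k (SymmetricAlgebra k V)).toLinearMap ∘ₗ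
      (convExp _ (ι_comp_apply_coaug hr)).ofConv) = 1 := by
    rw [h1, ← convExp_zero]
    congr 1
  exact congrArg WithConv.ofConv h2

/-- As `Δ` is a morphism of algebras and `Δ r = r ⊗ 1 + 1 ⊗ r`, the functional equation of the
exponential gives `Δ (exp r) = (exp r ⊗ 1) * (1 ⊗ exp r)`. -/
theorem comul_comp_convExp [CharZero k] [Coalgebra.IsCocomm k C] {r : C →ₗ[k] V}
    (hr : r (coaug k C) = 0) :
    TensorProduct.map
      (convExp (WithConv.toConv (SymmetricAlgebra.ι k V ∘ₗ r)) (ι_comp_apply_coaug hr)).ofConv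
      (convExp (WithConv.toConv (SymmetricAlgebra.ι k V ∘ₗ r)) (ι_comp_apply_coaug hr)).ofConv ∘ₗ
        Coalgebra.comul =
    Coalgebra.comul ∘ₗ
      (convExp (WithConv.toConv (SymmetricAlgebra.ι k V ∘ₗ r)) (ι_comp_apply_coaug hr)).ofConv := by
  set a := WithConv.toConv (SymmetricAlgebra.ι k V ∘ₗ r) with ha_def
  have ha : a (coaug k C) = 0 := ι_comp_apply_coaug hr
  let S := SymmetricAlgebra k V
  let i₁ : S →ₐ[k] S ⊗[k] S := Algebra.TensorProduct.includeLeft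
  let i₂ : S →ₐ[k] S ⊗[k] S := Algebra.TensorProduct.includeRight
  have h1 : WithConv.toConv (i₁.toLinearMap ∘ₗ a.ofConv) (coaug k C) = 0 := by
    change i₁ (a (coaug k C)) = 0
    rw [ha, map_zero]
  have h2 : WithConv.toConv (i₂.toLinearMap ∘ₗ a.ofConv) (coaug k C) = 0 := by
    change i₂ (a (coaug k C)) = 0
    rw [ha, map_zero]
  have h3 : WithConv.toConv ((Bialgebra.comulAlgHom k S).toLinearMap ∘ₗ a.ofConv) =
      WithConv.toConv (i₁.toLinearMap ∘ₗ a.ofConv) +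
        WithConv.toConv (i₂.toLinearMap ∘ₗ a.ofConv) := by
    ext x
    exact SymmetricAlgebra.comul_ι k V (r x)
  have h12 : (WithConv.toConv (i₁.toLinearMap ∘ₗ a.ofConv) +
      WithConv.toConv (i₂.toLinearMap ∘ₗ a.ofConv)) (coaug k C) = 0 := by
    rw [WithConv.ofConv_add, LinearMap.add_apply, h1, h2, add_zero]
  have h4 : WithConv.toConv ((Bialgebra.comulAlgHom k S).toLinearMap ∘ₗ (convExp a ha).ofConv) =
      WithConv.toConv (i₁.toLinearMap ∘ₗ (convExp a ha).ofConv) *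
        WithConv.toConv (i₂.toLinearMap ∘ₗ (convExp a ha).ofConv) := by
    rw [algHom_comp_convExp i₁ ha h1, algHom_comp_convExp i₂ ha h2, ← convExp_add h1 h2 h12,
      algHom_comp_convExp (Bialgebra.comulAlgHom k S) ha (by rw [h3]; exact h12)]
    congr 1
  have h5 : LinearMap.mul' k (S ⊗[k] S) ∘ₗ
      TensorProduct.map (i₁.toLinearMap ∘ₗ (convExp a ha).ofConv)
        (i₂.toLinearMap ∘ₗ (convExp a ha).ofConv) =
      TensorProduct.map (convExp a ha).ofConv (convExp a ha).ofConv := by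
    ext x y
    simp [i₁, i₂]
  rw [← h5, LinearMap.comp_assoc]
  exact (congrArg WithConv.ofConv h4).symm

variable [CharZero k] [Coalgebra.IsCocomm k C]

/-- The morphism of coalgebras `C → Sym^co V` with corestriction `r : C → V`, given by the
exponential of `r` in the convolution algebra. -/
def coalgExp (r : C →ₗ[k] V) (hr : r (coaug k C) = 0) : C →ₗc[k] SymmetricAlgebra k V where
  toLinearMap :=
    (convExp (WithConv.toConv (SymmetricAlgebra.ι k V ∘ₗ r)) (ι_comp_apply_coaug hr)).ofConv
  counit_comp := counit_comp_convExp hr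
  map_comp_comul := comul_comp_convExp hr

theorem coalgExp_primitive {r : C →ₗ[k] V} (hr : r (coaug k C) = 0) {x : C}
    (hx : x ∈ primitives k C) : coalgExp r hr x = SymmetricAlgebra.ι k V (r x) :=
  convExp_apply_primitive (ι_comp_apply_coaug hr) hx

theorem coalgExp_comp {B : Type*} [AddCommGroup B] [Module k B] [Coalgebra k B]
    [IsConilpotent k B] [Coalgebra.IsCocomm k B] (g : B →ₗc[k] C) {r : C →ₗ[k] V}
    (hr : r (coaug k C) = 0) (hs : (r ∘ₗ g.toLinearMap) (coaug k B) = 0) (x : B) :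
    coalgExp r hr (g x) = coalgExp (r ∘ₗ g.toLinearMap) hs x :=
  LinearMap.congr_fun (congrArg WithConv.ofConv
    (convExp_comp_coalgHom g (ι_comp_apply_coaug hr) (ι_comp_apply_coaug hs))) x

end

theorem symMap_coalgExp [CharZero k] [Coalgebra.IsCocomm k C] {V W : Type u} [AddCommGroup V]
    [Module k V] [AddCommGroup W] [Module k W] (f : V →ₗ[k] W) {r : C →ₗ[k] V}
    (hr : r (coaug k C) = 0) (hs : (f ∘ₗ r) (coaug k C) = 0) (x : C) :
    symMap k f (coalgExp r hr x) = coalgExp (f ∘ₗ r) hs x := by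
  have h0 : WithConv.toConv ((SymmetricAlgebra.lift (SymmetricAlgebra.ι k W ∘ₗ f)).toLinearMap ∘ₗ
      (SymmetricAlgebra.ι k V ∘ₗ r)) = WithConv.toConv (SymmetricAlgebra.ι k W ∘ₗ (f ∘ₗ r)) := by
    ext y
    simp
  have h1 := algHom_comp_convExp (SymmetricAlgebra.lift (SymmetricAlgebra.ι k W ∘ₗ f))
    (ι_comp_apply_coaug hr)
    ((LinearMap.congr_fun (congrArg WithConv.ofConv h0) _).trans (ι_comp_apply_coaug hs))
  have h2 : WithConv.toConv ((SymmetricAlgebra.lift (SymmetricAlgebra.ι k W ∘ₗ f)).toLinearMap ∘ₗ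
      (convExp _ (ι_comp_apply_coaug hr)).ofConv) = convExp _ (ι_comp_apply_coaug hs) := by
    rw [h1]
    congr 1
  exact LinearMap.congr_fun (congrArg WithConv.ofConv h2) x

/-- For a formal manifold, a linear retraction onto the primitive elements which vanishes at the
coaugmentation exponentiates to an isomorphism with the symmetric coalgebra. -/
theorem coalgExp_bijective [CharZero k] {C : Type u} [AddCommGroup C] [Module k C] [Coalgebra k C]
    [IsConilpotent k C] [Coalgebra.IsCocomm k C] [Module.Finite k (primitives k C)]
    (hC : IsFormalSubmersion k (Coalgebra.counitCoalgHom k C)) {r : C →ₗ[k] primitives k C}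
    (hr : r (coaug k C) = 0) (hr' : ∀ x : primitives k C, r x = x) :
    Function.Bijective (coalgExp r hr) := by
  have hprim : ∀ x : primitives k C, coalgExp r hr x = SymmetricAlgebra.ι k (primitives k C) x :=
    fun x => by rw [coalgExp_primitive hr x.2, hr']
  have hinj : Function.Injective (coalgExp r hr) := by
    refine injective_of_injective_on_primitives _ fun x hx h => ?_
    have h1 := hprim ⟨x, hx⟩
    rw [h, ← map_zero (SymmetricAlgebra.ι k (primitives k C))] at h1
    exact congrArg Subtype.val (symmetricAlgebra_ι_injective h1).symm
  refine ⟨hinj, surjective_of_isFormalSubmersion_counit hC _ hinj fun φ hφ => ?_⟩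
  have hφ' : ∀ x, φ (coalgExp r hr x) = 0 := fun x =>
    LinearMap.congr_fun (congrArg WithConv.ofConv hφ) x
  refine mem_maxIdeal_sq_of_vanishing φ ?_ fun v => ?_
  · rw [← coaug_symmetricAlgebra, ← map_coaug k (coalgExp r hr)]
    exact hφ' _
  · rw [← hprim]
    exact hφ' _

end Exponential

/-! ### Retractions onto primitive elements and PBW bases -/

section Assembly

variable (k : Type u) [Field k]

/-- The projection `x ↦ x - ε(x) 1` of a conilpotent coalgebra onto the kernel of its counit. -/
def reducedProj (C : Type v) [AddCommGroup C] [Module k C] [Coalgebra k C] [IsConilpotent k C] :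
    C →ₗ[k] C :=
  LinearMap.id - (Coalgebra.counit (R := k)).smulRight (coaug k C)

section

variable {k} {C : Type v} [AddCommGroup C] [Module k C] [Coalgebra k C] [IsConilpotent k C]

theorem reducedProj_apply (x : C) :
    reducedProj k C x = x - Coalgebra.counit (R := k) x • coaug k C :=
  rfl

theorem reducedProj_coaug : reducedProj k C (coaug k C) = 0 := by
  rw [reducedProj_apply, (coaug_isGroupLike k C).counit_eq_one, one_smul, sub_self]

theorem reducedProj_primitive {x : C} (hx : x ∈ primitives k C) : reducedProj k C x = x := by
  rw [reducedProj_apply, counit_primitive hx, zero_smul, sub_zero]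

theorem map_reducedProj {D : Type w} [AddCommGroup D] [Module k D] [Coalgebra k D]
    [IsConilpotent k D] (f : C →ₗc[k] D) (x : C) :
    f (reducedProj k C x) = reducedProj k D (f x) := by
  rw [reducedProj_apply, reducedProj_apply, map_sub, map_smul, map_coaug,
    CoalgHomClass.counit_comp_apply]

end

/-- The simplicial vector space underlying a simplicial pointed formal manifold. -/
abbrev underlyingSimplicial (X : SimplicialObject (FormalManifold k)) :
    SimplicialObject (ModuleCat.{u} k) :=
  X ⋙ toCoalg k ⋙ forget₂ (CoalgCat.{u} k) (ModuleCat.{u} k)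

/-- The inclusion of the primitive elements. -/
def primInclusion (X : SimplicialObject (FormalManifold k)) :
    primSimplicial k X ⟶ underlyingSimplicial k X where
  app Δ := ModuleCat.ofHom (primitives k (X.obj Δ).obj.obj).subtype
  naturality _ _ _ := rfl

instance (X : SimplicialObject (FormalManifold k)) : Mono (primInclusion k X) := by
  have : ∀ Δ, Mono ((primInclusion k X).app Δ) := fun Δ =>
    (ModuleCat.mono_iff_injective _).mpr (Submodule.subtype_injective _)
  exact NatTrans.mono_of_mono_app _

/-- Each simplicial pointed formal manifold has linear retractions onto the primitive elements which
vanish at the coaugmentations and commute with all simplicial operators which fix `0`. -/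
theorem exists_retraction_primitives (X : SimplicialObject (FormalManifold k)) :
    ∃ r : ∀ Δ, (X.obj Δ).obj.obj →ₗ[k] primitives k (X.obj Δ).obj.obj,
      (∀ Δ, r Δ (coaug k _) = 0) ∧ (∀ Δ (x : primitives k (X.obj Δ).obj.obj), r Δ x = x) ∧
      ∀ {Δ Δ' : SimplexCategoryᵒᵖ} (θ : Δ ⟶ Δ'), θ.unop.toOrderHom 0 = 0 →
        r Δ' ∘ₗ (X.map θ).hom.hom.toCoalgHom.toLinearMap =
          primitivesMap k (X.map θ).hom.hom.toCoalgHom ∘ₗ r Δ := by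
  obtain ⟨ρ, hρ, hρθ⟩ := exists_retraction_of_map_zero k (primInclusion k X)
  refine ⟨fun Δ => (ρ Δ).hom ∘ₗ reducedProj k (X.obj Δ).obj.obj, fun Δ => ?_, fun Δ x => ?_,
    fun {Δ Δ'} θ hθ => LinearMap.ext fun x => ?_⟩
  · exact (congrArg (ρ Δ).hom (reducedProj_coaug (C := (X.obj Δ).obj.obj))).trans (map_zero _)
  · exact (congrArg (ρ Δ).hom (reducedProj_primitive (C := (X.obj Δ).obj.obj) x.2)).trans
      (LinearMap.congr_fun (congrArg ModuleCat.Hom.hom (hρ Δ)) x)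
  · have h := LinearMap.congr_fun (congrArg ModuleCat.Hom.hom (hρθ θ hθ))
      (reducedProj k (X.obj Δ).obj.obj x)
    have h2 := map_reducedProj (X.map θ).hom.hom.toCoalgHom x
    exact (congrArg (ρ Δ').hom h2.symm).trans h

end Assembly

end

end PBW

theorem mainTheorem3 (k : Type u) [Field k] [CharZero k]
    (X : SimplicialObject (PBW.FormalManifold k))
    (hX : PBW.IsInftyGroupoid (PBW.covers k) X) :
    Nonempty (PBW.PBWBasis k X) := by
  obtain ⟨r, hr, hr', hrθ⟩ := PBW.exists_retraction_primitives k X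
  refine ⟨NatIso.ofComponents
    (fun Δ => (CoalgEquiv.ofBijective (f := PBW.coalgExp (r (op Δ.unop.obj)) (hr _))
      (PBW.coalgExp_bijective (X.obj (op Δ.unop.obj)).property (hr _) (hr' _))).toCoalgIso) ?_⟩
  intro Δ Δ' θ
  let θ' := (wideSubcategoryInclusion PBW.fixesZero).op.map θ
  have h := hrθ θ' θ.unop.2
  apply CoalgCat.hom_ext
  apply CoalgHom.ext
  intro x
  have hs : (r _ ∘ₗ (X.map θ').hom.hom.toCoalgHom.toLinearMap) (PBW.coaug k _) = 0 := by
    rw [h, LinearMap.comp_apply, hr, map_zero]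
  have hs' := hs
  rw [h] at hs'
  -- Both composites of the naturality square are exponentials, of two maps which agree by `h`.
  refine (PBW.coalgExp_comp (X.map θ').hom.hom.toCoalgHom (hr _) hs x).trans ?_
  refine Eq.trans ?_ (PBW.symMap_coalgExp (PBW.primitivesMap k (X.map θ').hom.hom.toCoalgHom)
    (hr _) hs' x).symm
  congr 1
  congr 1
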